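/- Let $d\ge 1$, let $\mathbb X\subseteq\mathbb R^d$ be a non-empty unbounded Borel set, and let $X=(X_n)_{n\ge 0}$ be a discrete-time, time-homogeneous Markov process on $\mathbb X$ started from a fixed (non-random) point $X_0\in\mathbb X$. Write $\Delta=X_1-X_0$, and write $\mathbb E_x$ for expectation when the process is started from $x\in\mathbb X$; put $M(x)=\mathbb E_x[\Delta\Delta^{\top}]$. Let $\|\cdot\|$ be the Euclidean norm, $\|\cdot\|_{\mathrm{op}}$ the corresponding operator norm of matrices, $S^{d-1}$ the unit sphere, $\hat x=x/\|x\|$ for $x\ne 0$, and $\hat 0=e_1$, the first standard basis vector. Assume: (A0) there is $p>2$ with $\sup_{x\in\mathbb X}\mathbb E_x[\|\Delta\|^p]<\infty$; (A1) $\mathbb E_x[\Delta]=0$ for all $x\in\mathbb X$; (A2) there is $v>0$ with $\operatorname{tr}M(x)=\mathbb E_x[\|\Delta\|^2]\ge v$ for all $x\in\mathbb X$; (A3) there is a function $\sigma^2$ from $S^{d-1}$ to the symmetric positive-definite $d\times d$ matrices such that $$\varepsilon(r):=\sup_{x\in\mathbb X:\ \|x\|\ge r}\|M(x)-\sigma^2(\hat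 x)\|_{\mathrm{op}}\to 0\qquad\text{as } r\to\infty;$$ (A4) there are constants $0<U<V<\infty$ such that $\langle u,\sigma^2(u)u\rangle=U$ and $\operatorname{tr}\sigma^2(u)=V$ for all $u\in S^{d-1}$. Call $X$ transient if $\lim_{n\to\infty}\|X_n\|=+\infty$ almost surely, and recurrent if there is a constant $r_0\in[0,\infty)$ such that $\liminf_{n\to\infty}\|X_n\|\le r_0$ almost surely. Then: (i) if $2U<V$, then $X$ is transient; (ii) if $2U>V$, then $X$ is recurrent; (iii) if $2U=V$ and $\varepsilon(r)=O(r^{-\delta_0})$ as $r\to\infty$ for some $\delta_0>0$, then $X$ is recurrent. -/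

import Mathlib

open MeasureTheory ProbabilityTheory Filter Topology
open scoped ENNReal NNReal

namespace ZeroDriftWalk

/-- `d`-dimensional Euclidean space. -/
abbrev E (d : ℕ) : Type := EuclideanSpace ℝ (Fin d)

/-- The unit sphere of `ℝ^d`. -/
abbrev S (d : ℕ) : Type := Metric.sphere (0 : E d) 1

/-- The direction `x / ‖x‖` of `x`, with the convention that the direction of `0` is the first
standard basis vector. -/
noncomputable def dir {d : ℕ} [NeZero d] (x : E d) : S d :=
  open Classical in
  if hx : x = 0 then ⟨EuclideanSpace.single 0 1, by simp⟩
  else ⟨‖x‖⁻¹ • x, by simp [norm_smul, hx]⟩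

/-- `X` is a time-homogeneous Markov process on `𝕏` with one-step transition kernel `P`,
started from the fixed point `x₀`: almost surely `X 0 = x₀`, and for every `n` the conditional law
of `X (n + 1)` given `X 0, …, X n` is `P (X n)`. -/
structure IsMarkovProcess {d : ℕ} {𝕏 : Set (E d)} (P : Kernel 𝕏 𝕏) (x₀ : 𝕏)
    {Ω : Type*} [MeasurableSpace Ω] (Pr : Measure Ω) (X : ℕ → Ω → 𝕏) : Prop where
  measurable : ∀ n, Measurable (X n)
  start : ∀ᵐ ω ∂Pr, X 0 ω = x₀
  markov : ∀ n : ℕ,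
    HasCondDistrib (X (n + 1)) (fun ω (k : Set.Iic n) => X k ω)
      (P.comap (fun h : Set.Iic n → 𝕏 => h ⟨n, le_refl n⟩) (measurable_pi_apply _)) Pr

section Increments

variable {d : ℕ} {𝕏 : Set (E d)}

/-- The mean vector `μ(x) = 𝔼_x[Δ]` of the increment `Δ = X 1 - X 0` from `x`. -/
noncomputable def drift (P : Kernel 𝕏 𝕏) (x : 𝕏) : E d :=
  ∫ y, ((y : E d) - (x : E d)) ∂(P x)

/-- The matrix `M(x) = 𝔼_x[Δ Δᵀ]` of the increment `Δ = X 1 - X 0` from `x`. -/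
noncomputable def covMatrix (P : Kernel 𝕏 𝕏) (x : 𝕏) : Matrix (Fin d) (Fin d) ℝ :=
  Matrix.of fun i j => ∫ y, ((y : E d) - (x : E d)) i * ((y : E d) - (x : E d)) j ∂(P x)

/-- Increments have uniformly bounded `p`-th moments for some `p > 2`. -/
def BoundedMoments (P : Kernel 𝕏 𝕏) : Prop :=
  ∃ p : ℝ, 2 < p ∧ (⨆ x : 𝕏, ∫⁻ y, ‖(y : E d) - (x : E d)‖ₑ ^ p ∂(P x)) < ∞

/-- Increments have mean zero. -/
def ZeroDrift (P : Kernel 𝕏 𝕏) : Prop :=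
  ∀ x : 𝕏, drift P x = 0

/-- Increments are uniformly non-degenerate. -/
def UniformlyNondegenerate (P : Kernel 𝕏 𝕏) : Prop :=
  ∃ v : ℝ, 0 < v ∧ ∀ x : 𝕏, v ≤ (covMatrix P x).trace

/-- `ε(r)`, the supremum over `x ∈ 𝕏` with `‖x‖ ≥ r` of the operator norm (with respect to the
Euclidean norm) of `M(x) - σ²(x / ‖x‖)`, as an element of `[0, ∞]`. -/
noncomputable def covError [NeZero d] (P : Kernel 𝕏 𝕏)
    (σsq : S d → Matrix (Fin d) (Fin d) ℝ) (r : ℝ) : ℝ≥0∞ :=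
  ⨆ x : 𝕏, ⨆ _ : r ≤ ‖(x : E d)‖,
    ‖Matrix.toEuclideanCLM (n := Fin d) (𝕜 := ℝ) (covMatrix P x - σsq (dir (x : E d)))‖ₑ

/-- `σ²` is positive-definite-matrix valued and is the limit of the increment covariance along
rays, uniformly. -/
def CovLimit [NeZero d] (P : Kernel 𝕏 𝕏) (σsq : S d → Matrix (Fin d) (Fin d) ℝ) : Prop :=
  (∀ u, (σsq u).PosDef) ∧ Tendsto (covError P σsq) atTop (𝓝 0)

end Increments

/-- The radial variance `⟨u, σ²(u) u⟩` is constantly `U` and the trace of `σ²(u)` is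
constantly `V`, where `0 < U < V`. -/
def CovForm {d : ℕ} (σsq : S d → Matrix (Fin d) (Fin d) ℝ) (U V : ℝ) : Prop :=
  0 < U ∧ U < V ∧ ∀ u : S d,
    inner ℝ (u : E d) (Matrix.toEuclideanCLM (n := Fin d) (𝕜 := ℝ) (σsq u) (u : E d)) = U ∧
    (σsq u).trace = V

/-- `ε(r) = O(r ^ (-δ₀))` as `r → ∞`, for some `δ₀ > 0`. -/
def PolynomialRate (ε : ℝ → ℝ≥0∞) : Prop :=
  ∃ δ₀ : ℝ, 0 < δ₀ ∧ ∃ C : ℝ, ∀ᶠ r : ℝ in atTop, ε r ≤ ENNReal.ofReal (C * r ^ (-δ₀))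

section LongTime

variable {d : ℕ} {𝕏 : Set (E d)} {Ω : Type*} [MeasurableSpace Ω]

/-- Almost surely `‖X n‖ → ∞`. -/
def IsTransient (Pr : Measure Ω) (X : ℕ → Ω → 𝕏) : Prop :=
  ∀ᵐ ω ∂Pr, Tendsto (fun n => ‖(X n ω : E d)‖) atTop atTop

/-- For some deterministic constant `r₀ < ∞`, almost surely `liminf ‖X n‖ ≤ r₀`
(the `liminf` is taken in `[0, ∞]`). -/
def IsRecurrent (Pr : Measure Ω) (X : ℕ → Ω → 𝕏) : Prop :=
  ∃ r₀ : ℝ≥0, ∀ᵐ ω ∂Pr, liminf (fun n => ‖(X n ω : E d)‖ₑ) atTop ≤ (r₀ : ℝ≥0∞)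

end LongTime

end ZeroDriftWalk

/-!
# Recurrence and transience of zero-drift walks in many dimensions

The proof is by Lyapunov functions of `L(x) = max 1 (log ‖x‖²)` (`logSq`). By a second-order
Taylor expansion, the mean increment of `log ‖X n‖²` from a point `x` at distance `r` from the
origin is `(tr M(x) - 2 ⟪x̂, M(x) x̂⟫) / r²` up to smaller terms, which is about `(V - 2U) / r²`.

* If `2U < V`, this is positive and `1 / L` has negative drift far from the origin
  (`exists_lintegral_inv_logSq_le`). As `1 / L` vanishes at infinity, the maximal inequality
  `IsMarkovProcess.measure_hit_le` shows that a walk which has reached a large level is unlikely to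
  come back to a fixed ball. Every level is reached, since a truncated quadratic function shows that
  no ball can contain the walk for ever (`IsMarkovProcess.ae_exists_lt_norm`); this is where the
  uniform nondegeneracy is used.
* If `2U ≥ V`, the concavity of the outer logarithm in `log L` contributes `-2U / (r² L²)` to the
  drift, next to the main term `(V - 2U + O(ε(r))) / (r² L)`. For large `r` the main term is
  nonpositive if `2U > V`, and it is smaller than the contribution of the concavity if `2U = V` and
  `ε(r) log r → 0` (`exists_lintegral_log_logSq_le`). As the drift is strictly negative, a path
  staying away from the origin would have to go to infinity, and `log L` with it, whereas the mean
  of `log L` along such paths stays bounded (`IsMarkovProcess.ae_exists_norm_lt`).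

Moments of order `2 < q ≤ 3` control the remainders without a truncation of the increments: the
expansions `log_logSq_add_le` and `inv_logSq_add_le` hold for all increments `y`, with remainder
`500 (‖y‖ / r) ^ q`, whose mean `O(r ^ (-q))` is negligible against `1 / (r² L²)`.
-/

namespace ZeroDriftWalk

/-! ### Supermartingale estimates for Markov processes -/

section Markov

variable {d : ℕ} {𝕏 : Set (E d)} {P : Kernel 𝕏 𝕏} {x₀ : 𝕏}
  {Ω : Type*} {mΩ : MeasurableSpace Ω} {Pr : Measure Ω} {X : ℕ → Ω → 𝕏}

/-- The σ-algebra generated by `X 0, …, X n`. -/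
@[reducible] def past (X : ℕ → Ω → 𝕏) (n : ℕ) : MeasurableSpace Ω :=
  MeasurableSpace.comap (fun ω (k : Set.Iic n) => X k ω) inferInstance

lemma measurable_past {k n : ℕ} (h : k ≤ n) : Measurable[past X n] (X k) :=
  (measurable_pi_apply (⟨k, h⟩ : Set.Iic n)).comp
    (comap_measurable (fun ω (k : Set.Iic n) => X k ω))

lemma past_mono {m n : ℕ} (h : m ≤ n) : past X m ≤ past X n := by
  refine Measurable.comap_le ?_
  exact @measurable_pi_lambda _ _ _ (past X n) _ _ fun k => measurable_past (k.2.trans h)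

lemma past_le (hX : ∀ n, Measurable (X n)) (n : ℕ) : past X n ≤ mΩ :=
  Measurable.comap_le (measurable_pi_lambda _ fun k => hX k)

/-- The Markov property, integrated over an event of the past. -/
lemma IsMarkovProcess.setLIntegral_succ [IsMarkovKernel P] [IsProbabilityMeasure Pr]
    (hX : IsMarkovProcess P x₀ Pr X) {n : ℕ} {A : Set Ω} (hA : MeasurableSet[past X n] A)
    {f : 𝕏 → ℝ≥0∞} (hf : Measurable f) :
    ∫⁻ ω in A, f (X (n + 1) ω) ∂Pr = ∫⁻ ω in A, ∫⁻ y, f y ∂(P (X n ω)) ∂Pr := by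
  obtain ⟨T, hT, rfl⟩ := hA
  have hH : Measurable (fun ω (k : Set.Iic n) => X k ω) :=
    measurable_pi_lambda _ fun k => hX.measurable k
  have hf2 : Measurable fun z : (Set.Iic n → 𝕏) × 𝕏 => f z.2 := hf.comp measurable_snd
  have key := (hX.markov n).map_eq
  have h1 : ∫⁻ z in T ×ˢ Set.univ, f z.2
      ∂(Pr.map (fun ω => ((fun (k : Set.Iic n) => X k ω), X (n + 1) ω)))
      = ∫⁻ ω in (fun ω (k : Set.Iic n) => X k ω) ⁻¹' T, f (X (n + 1) ω) ∂Pr := by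
    rw [setLIntegral_map (f := fun z => f z.2) (hT.prod MeasurableSet.univ)
      hf2 (hH.prodMk (hX.measurable _))]
    congr 2
    ext ω
    simp
  have h2 : Measurable fun g : Set.Iic n → 𝕏 => ∫⁻ y, f y ∂(P (g ⟨n, le_refl n⟩)) :=
    (hf.lintegral_kernel (κ := P)).comp (measurable_pi_apply (⟨n, le_refl n⟩ : Set.Iic n))
  have h3 := setLIntegral_map hT h2 hH (μ := Pr)
  refine h1.symm.trans ((congrArg (fun μ => ∫⁻ z in T ×ˢ Set.univ, f z.2 ∂μ) key).trans ?_)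
  refine (Measure.setLIntegral_compProd (f := fun z => f z.2) hf2 hT
    MeasurableSet.univ).trans ?_
  simp only [Measure.restrict_univ]
  exact h3

/-- The event that `A` is not left between the times `m` and `n`. -/
def staysIn (X : ℕ → Ω → 𝕏) (A : Set 𝕏) (m n : ℕ) : Set Ω :=
  {ω | ∀ k, m ≤ k → k ≤ n → X k ω ∈ A}

lemma measurableSet_staysIn {A : Set 𝕏} (hA : MeasurableSet A) (m n : ℕ) :
    MeasurableSet[past X n] (staysIn X A m n) := by
  have : staysIn X A m n = ⋂ k, ⋂ _ : m ≤ k, ⋂ _ : k ≤ n, X k ⁻¹' A := by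
    ext ω; simp [staysIn]
  rw [this]
  exact .iInter fun k => .iInter fun _ => .iInter fun hk => measurable_past hk hA

lemma staysIn_succ {A : Set 𝕏} {m n : ℕ} (h : m ≤ n + 1) :
    staysIn X A m (n + 1) = staysIn X A m n ∩ X (n + 1) ⁻¹' A := by
  ext ω
  constructor
  · intro hω
    exact ⟨fun k h1 h2 => hω k h1 (by omega), hω _ h le_rfl⟩
  · rintro ⟨h1, h2⟩ k hk hk'
    rcases Nat.lt_or_ge n k with h3 | h3
    · obtain rfl : k = n + 1 := by omega
      exact h2
    · exact h1 k hk h3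

/-- A function `W` which is at least `c` off `A`, and whose mean decreases by at least `h` in each
step from `A`, controls the exit from `A` and the time spent in `A` before it: this is optional
stopping for the nonnegative supermartingale `W (X n)`, stopped when `X` leaves `A` after time
`m`, on an event `S` determined by time `m`. -/
lemma IsMarkovProcess.lintegral_stopped_le [IsMarkovKernel P] [IsProbabilityMeasure Pr]
    (hX : IsMarkovProcess P x₀ Pr X) {A : Set 𝕏} (hA : MeasurableSet A)
    {W h : 𝕏 → ℝ≥0∞} (hW : Measurable W) (hh : Measurable h) {c : ℝ≥0∞}
    (hc : ∀ x ∉ A, c ≤ W x) (hPW : ∀ x ∈ A, ∫⁻ y, W y ∂(P x) + h x ≤ W x)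
    {m : ℕ} {T : Set Ω} (hT : MeasurableSet[past X m] T) (j : ℕ) :
    ∫⁻ ω in T ∩ staysIn X A m (m + j), W (X (m + j) ω) ∂Pr
      + c * Pr (T \ staysIn X A m (m + j))
      + ∑ i ∈ Finset.range j, ∫⁻ ω in T ∩ staysIn X A m (m + i), h (X (m + i) ω) ∂Pr
      ≤ ∫⁻ ω in T, W (X m ω) ∂Pr := by
  have hle := past_le hX.measurable
  have hE : ∀ i, MeasurableSet[past X (m + i)] (T ∩ staysIn X A m (m + i)) := fun i =>
    MeasurableSet.inter (past_mono (Nat.le_add_right m i) _ hT) (measurableSet_staysIn hA _ _)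
  -- leaving `A` costs at least `c`
  have hsplit : ∀ (B : Set Ω) (n : ℕ), MeasurableSet B →
      ∫⁻ ω in B ∩ X n ⁻¹' A, W (X n ω) ∂Pr + c * Pr (B \ X n ⁻¹' A)
        ≤ ∫⁻ ω in B, W (X n ω) ∂Pr := by
    intro B n hB
    rw [← lintegral_inter_add_sdiff (fun ω => W (X n ω)) B (hX.measurable n hA)]
    gcongr
    rw [← setLIntegral_const]
    exact setLIntegral_mono' (hB.diff (hX.measurable n hA)) fun ω hω => hc _ hω.2
  induction j with
  | zero =>
    have h0 : staysIn X A m (m + 0) = X m ⁻¹' A := by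
      ext ω
      constructor
      · intro hω; exact hω m le_rfl le_rfl
      · intro hω k h1 h2
        obtain rfl : k = m := by omega
        exact hω
    rw [h0]
    simpa using hsplit T m (hle m _ hT)
  | succ j ih =>
    refine le_trans ?_ ih
    rw [Finset.sum_range_succ, ← add_assoc m j 1, staysIn_succ (by omega : m ≤ m + j + 1)]
    have hB := hle _ _ (hE j)
    have h1 : T \ (staysIn X A m (m + j) ∩ X (m + j + 1) ⁻¹' A)
        ⊆ (T \ staysIn X A m (m + j))
          ∪ ((T ∩ staysIn X A m (m + j)) \ X (m + j + 1) ⁻¹' A) := by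
      intro ω hω
      by_cases h2 : ω ∈ staysIn X A m (m + j)
      · exact Or.inr ⟨⟨hω.1, h2⟩, fun h3 => hω.2 ⟨h2, h3⟩⟩
      · exact Or.inl ⟨hω.1, h2⟩
    have h2 := hsplit _ (m + j + 1) hB
    rw [hX.setLIntegral_succ (hE j) hW, Set.inter_assoc] at h2
    have h3 : ∫⁻ ω in T ∩ staysIn X A m (m + j), ∫⁻ y, W y ∂(P (X (m + j) ω)) ∂Pr
        + ∫⁻ ω in T ∩ staysIn X A m (m + j), h (X (m + j) ω) ∂Pr
        ≤ ∫⁻ ω in T ∩ staysIn X A m (m + j), W (X (m + j) ω) ∂Pr := by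
      rw [← lintegral_add_right (g := fun ω => h (X (m + j) ω)) _ (hh.comp (hX.measurable _))]
      exact setLIntegral_mono' hB fun ω hω => hPW _ (hω.2 _ (Nat.le_add_right _ _) le_rfl)
    have h4 : c * Pr (T \ (staysIn X A m (m + j) ∩ X (m + j + 1) ⁻¹' A))
        ≤ c * Pr (T \ staysIn X A m (m + j))
          + c * Pr ((T ∩ staysIn X A m (m + j)) \ X (m + j + 1) ⁻¹' A) := by
      rw [← mul_add]
      gcongr
      exact (measure_mono h1).trans (measure_union_le _ _)
    set S1 := ∑ i ∈ Finset.range j, ∫⁻ ω in T ∩ staysIn X A m (m + i), h (X (m + i) ω) ∂Pr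
    calc _ ≤ _ := add_le_add_left (add_le_add_right h4 _) _
      _ = (∫⁻ ω in T ∩ (staysIn X A m (m + j) ∩ X (m + j + 1) ⁻¹' A), W (X (m + j + 1) ω) ∂Pr
            + c * Pr ((T ∩ staysIn X A m (m + j)) \ X (m + j + 1) ⁻¹' A))
          + ∫⁻ ω in T ∩ staysIn X A m (m + j), h (X (m + j) ω) ∂Pr
          + (c * Pr (T \ staysIn X A m (m + j)) + S1) := by ring
      _ ≤ _ := by
        rw [add_assoc _ _ S1]
        exact add_le_add_left ((add_le_add_left h2 _).trans h3) _

/-- The total time spent in `A`, weighted by `h`, before leaving `A` for the first time after `m`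
is almost surely finite. -/
lemma IsMarkovProcess.ae_tsum_ne_top [IsMarkovKernel P] [IsProbabilityMeasure Pr]
    (hX : IsMarkovProcess P x₀ Pr X) {A : Set 𝕏} (hA : MeasurableSet A)
    {W h : 𝕏 → ℝ≥0∞} (hW : Measurable W) (hWtop : ∀ x, W x ≠ ∞) (hh : Measurable h)
    (hPW : ∀ x ∈ A, ∫⁻ y, W y ∂(P x) + h x ≤ W x) (m : ℕ) :
    ∀ᵐ ω ∂Pr, (∀ k, m ≤ k → X k ω ∈ A) →
      ∑' i, h (X (m + i) ω) ≠ ∞ ∧ liminf (fun i => W (X (m + i) ω)) atTop ≠ ∞ := by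
  have hle := past_le hX.measurable
  have main : ∀ b : ℕ, ∀ᵐ ω ∂Pr, W (X m ω) ≤ b → (∀ k, m ≤ k → X k ω ∈ A) →
      ∑' i, h (X (m + i) ω) ≠ ∞ ∧ liminf (fun i => W (X (m + i) ω)) atTop ≠ ∞ := by
    intro b
    -- on `T` the mean of `W (X m)` is finite, which need not hold on the whole space
    set T : Set Ω := X m ⁻¹' {x | W x ≤ b} with hTdef
    have hT : MeasurableSet[past X m] T :=
      measurable_past le_rfl (measurableSet_le hW measurable_const)
    have hbound : ∫⁻ ω in T, W (X m ω) ∂Pr ≤ b := by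
      calc _ ≤ ∫⁻ _ in T, (b : ℝ≥0∞) ∂Pr := setLIntegral_mono' (hle m _ hT) fun ω hω => hω
        _ ≤ b := by
          rw [setLIntegral_const]
          exact mul_le_of_le_one_right' prob_le_one
    have hst := fun j => (hX.lintegral_stopped_le hA hW hh (c := 0) (by simp) hPW hT j).trans hbound
    set D : Set Ω := T ∩ {ω | ∀ k, m ≤ k → X k ω ∈ A} with hD
    have hDm : MeasurableSet D := by
      refine (hle m _ hT).inter ?_
      have : {ω | ∀ k, m ≤ k → X k ω ∈ A} = ⋂ k, ⋂ _ : m ≤ k, X k ⁻¹' A := by ext; simp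
      rw [this]
      exact .iInter fun k => .iInter fun _ => hX.measurable k hA
    have hDsub : ∀ i, D ⊆ T ∩ staysIn X A m (m + i) := fun i ω hω =>
      ⟨hω.1, fun k h1 _ => hω.2 k h1⟩
    have h1 : ∫⁻ ω in D, ∑' i, h (X (m + i) ω) ∂Pr ≤ b := by
      rw [lintegral_tsum (f := fun i ω => h (X (m + i) ω))
        fun i => (hh.comp (hX.measurable _)).aemeasurable]
      refine ENNReal.tsum_le_of_sum_range_le fun j => ?_
      calc _ ≤ _ := Finset.sum_le_sum fun i _ => lintegral_mono_set (hDsub i)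
        _ ≤ _ := le_add_self
        _ ≤ b := hst j
    have h2 : ∫⁻ ω in D, liminf (fun i => W (X (m + i) ω)) atTop ∂Pr ≤ b := by
      refine (lintegral_liminf_le fun i => hW.comp (hX.measurable _)).trans ?_
      refine (liminf_le_liminf (v := fun _ => (b : ℝ≥0∞)) (Eventually.of_forall fun j => ?_)).trans
        (by simp)
      calc _ ≤ _ := lintegral_mono_set (hDsub j)
        _ ≤ _ := le_add_right le_self_add
        _ ≤ b := hst j
    have hb : (b : ℝ≥0∞) < ∞ := ENNReal.natCast_lt_top b
    have g1 := ae_lt_top (Measurable.tsum fun i => hh.comp (hX.measurable (m + i)))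
      (h1.trans_lt hb).ne
    have g2 := ae_lt_top (Measurable.liminf fun i => hW.comp (hX.measurable (m + i)))
      (h2.trans_lt hb).ne
    rw [ae_restrict_iff' hDm] at g1 g2
    filter_upwards [g1, g2] with ω k1 k2 hω hω'
    exact ⟨(k1 ⟨hω, hω'⟩).ne, (k2 ⟨hω, hω'⟩).ne⟩
  filter_upwards [ae_all_iff.2 main] with ω hω hA'
  obtain ⟨b, hb⟩ := ENNReal.exists_nat_gt (hWtop (X m ω))
  exact hω b hb.le hA'

/-- Maximal inequality: if `W` does not increase in the mean off `{c ≤ W}`, and `W ≤ b` at time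
`m` on an event `T` of the past of `m`, then `c * Pr (T, W (X n) ≥ c for some n ≥ m)` is at most
`b * Pr T`. -/
lemma IsMarkovProcess.measure_hit_le [IsMarkovKernel P] [IsProbabilityMeasure Pr]
    (hX : IsMarkovProcess P x₀ Pr X) {W : 𝕏 → ℝ≥0∞} (hW : Measurable W) {c b : ℝ≥0∞}
    (hPW : ∀ x, W x < c → ∫⁻ y, W y ∂(P x) ≤ W x)
    {m : ℕ} {T : Set Ω} (hT : MeasurableSet[past X m] T) (hTb : ∀ ω ∈ T, W (X m ω) ≤ b) :
    c * Pr {ω | ω ∈ T ∧ ∃ n, m ≤ n ∧ c ≤ W (X n ω)} ≤ b * Pr T := by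
  have hA : MeasurableSet {x | W x < c} := measurableSet_lt hW measurable_const
  have hst := fun j => hX.lintegral_stopped_le hA hW (h := 0) measurable_const (c := c)
    (fun x hx => not_lt.1 hx) (fun x hx => by simpa using hPW x hx) hT j
  have hb : ∫⁻ ω in T, W (X m ω) ∂Pr ≤ b * Pr T := by
    rw [← setLIntegral_const]
    exact setLIntegral_mono' (past_le hX.measurable m _ hT) hTb
  have hU : {ω | ω ∈ T ∧ ∃ n, m ≤ n ∧ c ≤ W (X n ω)}
      = ⋃ j, T \ staysIn X {x | W x < c} m (m + j) := by
    ext ω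
    simp only [Set.mem_ofPred_eq, Set.mem_iUnion, Set.mem_sdiff, staysIn, not_forall, not_lt,
      exists_prop, exists_and_left]
    constructor
    · rintro ⟨h1, n, hn, hn'⟩
      exact ⟨h1, n - m, n, hn, by omega, hn'⟩
    · rintro ⟨h1, j, n, hn, _, hn'⟩
      exact ⟨h1, n, hn, hn'⟩
  have hmono : Monotone fun j => T \ staysIn X {x | W x < c} m (m + j) := by
    intro i j hij
    refine Set.sdiff_subset_sdiff_right fun ω hω k h1 h2 => hω k h1 (by omega)
  rw [hU, hmono.measure_iUnion, ENNReal.mul_iSup]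
  refine iSup_le fun j => ?_
  exact (le_add_self.trans le_self_add).trans ((hst j).trans hb)

end Markov

/-! ### Pointwise expansions of the Lyapunov functions -/

section Pointwise

lemma abs_log_one_add_sub_le {t : ℝ} (ht : |t| < 1) :
    |Real.log (1 + t) - (t - t ^ 2 / 2)| ≤ |t| ^ 3 / (1 - |t|) := by
  have h := Real.abs_log_sub_add_sum_range_le (x := -t) (by simpa using ht) 2
  simp only [Finset.sum_range_succ, Finset.sum_range_zero, abs_neg, sub_neg_eq_add] at h
  convert h using 2
  push_cast
  ring

/-- Second-order expansion of `log (1 + s + ρ²)`, where `1 + s + ρ²` is the ratio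
`‖x + y‖² / ‖x‖²` for `s = 2 ⟪x, y⟫ / ‖x‖²` and `ρ = ‖y‖ / ‖x‖`. -/
lemma abs_log_one_add_add_sq_sub_le {s ρ : ℝ} (hρ0 : 0 ≤ ρ) (hρ : ρ ≤ 1 / 4) (hs : |s| ≤ 2 * ρ) :
    |Real.log (1 + s + ρ ^ 2) - (s + ρ ^ 2 - s ^ 2 / 2)| ≤ 30 * ρ ^ 3 := by
  have ht : |s + ρ ^ 2| ≤ 9 / 4 * ρ := by
    refine (abs_add_le _ _).trans ?_
    rw [abs_of_nonneg (sq_nonneg ρ)]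
    nlinarith
  have ht1 : |s + ρ ^ 2| ≤ 9 / 16 := by linarith
  have h := abs_log_one_add_sub_le (t := s + ρ ^ 2) (by linarith)
  have h2 : |s + ρ ^ 2| ^ 3 / (1 - |s + ρ ^ 2|) ≤ 27 * ρ ^ 3 := by
    rw [div_le_iff₀ (by linarith)]
    have h3 : |s + ρ ^ 2| ^ 3 ≤ (9 / 4 * ρ) ^ 3 := pow_le_pow_left₀ (abs_nonneg _) ht 3
    have : 0 ≤ ρ ^ 3 := by positivity
    nlinarith
  have h4 : |s * ρ ^ 2 + ρ ^ 4 / 2| ≤ 3 * ρ ^ 3 := by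
    refine (abs_add_le _ _).trans ?_
    rw [abs_mul, abs_of_nonneg (sq_nonneg ρ), abs_of_nonneg (by positivity : 0 ≤ ρ ^ 4 / 2)]
    have := mul_le_mul_of_nonneg_right hs (sq_nonneg ρ)
    have h5 : ρ ^ 4 ≤ ρ ^ 3 := pow_le_pow_of_le_one hρ0 (by linarith) (by norm_num)
    nlinarith
  rw [← add_assoc] at h
  rw [abs_le] at h h4 ⊢
  constructor <;> nlinarith [h.1, h.2, h4.1, h4.2]

/-- First- and second-order consequences of the expansion of `ℓ = log (1 + s + ρ²)`. -/
lemma abs_log_one_add_add_sq_le {s ρ : ℝ} (hρ0 : 0 ≤ ρ) (hρ : ρ ≤ 1 / 4) (hs : |s| ≤ 2 * ρ) :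
    |Real.log (1 + s + ρ ^ 2)| ≤ 5 * ρ ∧
      s ^ 2 - 44 * ρ ^ 3 ≤ Real.log (1 + s + ρ ^ 2) ^ 2 := by
  have h := abs_log_one_add_add_sq_sub_le hρ0 hρ hs
  set l := Real.log (1 + s + ρ ^ 2)
  have hs2 : s ^ 2 ≤ 4 * ρ ^ 2 := by
    have := sq_le_sq' (abs_le.1 hs).1 (abs_le.1 hs).2
    linarith
  have h3 : ρ ^ 3 ≤ ρ ^ 2 / 4 := by nlinarith [sq_nonneg ρ]
  have he : |l - s| ≤ 11 * ρ ^ 2 := by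
    rw [abs_le] at h ⊢
    constructor <;> nlinarith [h.1, h.2, sq_nonneg s, sq_nonneg ρ]
  constructor
  · have h4 : |l| ≤ |l - s| + |s| := by simpa using abs_add_le (l - s) s
    nlinarith
  · have h5 : |s * (l - s)| ≤ 2 * ρ * (11 * ρ ^ 2) := by
      rw [abs_mul]
      exact mul_le_mul hs he (abs_nonneg _) (by linarith)
    nlinarith [(abs_le.1 h5).1, sq_nonneg (l - s)]

/-- Small jumps: expansion of `log (L + ℓ)` at `L`, with `ℓ = log (1 + s + ρ²)`. -/
lemma log_add_log_le {s ρ L : ℝ} (hρ0 : 0 ≤ ρ) (hρ : ρ ≤ 1 / 4) (hs : |s| ≤ 2 * ρ)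
    (hL : 5 / 2 ≤ L) :
    Real.log (L + Real.log (1 + s + ρ ^ 2)) ≤
      Real.log L + (s + ρ ^ 2 - s ^ 2 / 2) / L - s ^ 2 / (2 * L ^ 2) + 500 * ρ ^ 3 := by
  have h := abs_log_one_add_add_sq_sub_le hρ0 hρ hs
  obtain ⟨h1, h2⟩ := abs_log_one_add_add_sq_le hρ0 hρ hs
  set l := Real.log (1 + s + ρ ^ 2)
  have hL0 : 0 < L := by linarith
  have hρ3 : 0 ≤ ρ ^ 3 := by positivity
  have hu : |l / L| ≤ 2 * ρ := by
    rw [abs_div, abs_of_pos hL0, div_le_iff₀ hL0]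
    nlinarith
  have hu1 : |l / L| ≤ 1 / 2 := by linarith
  have h3 := abs_log_one_add_sub_le (t := l / L) (by linarith)
  have h4 : |l / L| ^ 3 / (1 - |l / L|) ≤ 16 * ρ ^ 3 := by
    rw [div_le_iff₀ (by linarith)]
    have h5 : |l / L| ^ 3 ≤ (2 * ρ) ^ 3 := pow_le_pow_left₀ (abs_nonneg _) hu 3
    nlinarith
  have h6 : Real.log (L + l) = Real.log L + Real.log (1 + l / L) := by
    rw [← Real.log_mul hL0.ne' (by linarith [(abs_le.1 hu1).1])]
    congr 1
    field_simp
  have h7 : l / L ≤ (s + ρ ^ 2 - s ^ 2 / 2) / L + 30 * ρ ^ 3 := by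
    have : l / L ≤ ((s + ρ ^ 2 - s ^ 2 / 2) + 30 * ρ ^ 3) / L := by
      gcongr
      linarith [(abs_le.1 h).2]
    refine this.trans ?_
    rw [add_div]
    gcongr
    exact div_le_self (by positivity) (by linarith)
  have h8 : s ^ 2 / (2 * L ^ 2) - 44 * ρ ^ 3 ≤ (l / L) ^ 2 / 2 := by
    have : (s ^ 2 - 44 * ρ ^ 3) / (2 * L ^ 2) ≤ l ^ 2 / (2 * L ^ 2) := by gcongr
    have h9 : 44 * ρ ^ 3 / (2 * L ^ 2) ≤ 44 * ρ ^ 3 :=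
      div_le_self (by positivity) (by nlinarith)
    rw [sub_div] at this
    have h10 : (l / L) ^ 2 / 2 = l ^ 2 / (2 * L ^ 2) := by field_simp
    linarith
  rw [h6]
  linarith [(abs_le.1 h3).2]

/-- Small jumps: expansion of `1 / (L + ℓ)` at `L`, with `ℓ = log (1 + s + ρ²)`. -/
lemma inv_add_log_le {s ρ L : ℝ} (hρ0 : 0 ≤ ρ) (hρ : ρ ≤ 1 / 4) (hs : |s| ≤ 2 * ρ)
    (hL : 5 / 2 ≤ L) :
    (L + Real.log (1 + s + ρ ^ 2))⁻¹ ≤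
      L⁻¹ - (s + ρ ^ 2 - s ^ 2 / 2) / L ^ 2 + 50 * ρ ^ 2 / L ^ 3 + 500 * ρ ^ 3 := by
  have h := abs_log_one_add_add_sq_sub_le hρ0 hρ hs
  obtain ⟨h1, -⟩ := abs_log_one_add_add_sq_le hρ0 hρ hs
  set l := Real.log (1 + s + ρ ^ 2)
  have hL0 : 0 < L := by linarith
  have hρ3 : 0 ≤ ρ ^ 3 := by positivity
  have hl2 : l ^ 2 ≤ 25 * ρ ^ 2 := by
    have := sq_le_sq' (abs_le.1 h1).1 (abs_le.1 h1).2
    linarith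
  have hl : -(L / 2) ≤ l := by linarith [(abs_le.1 h1).1]
  have hLl : 0 < L + l := by linarith
  have h2 : (L + l)⁻¹ ≤ L⁻¹ - l / L ^ 2 + 2 * l ^ 2 / L ^ 3 := by
    rw [inv_le_iff_one_le_mul₀ hLl]
    have : (L⁻¹ - l / L ^ 2 + 2 * l ^ 2 / L ^ 3) * (L + l)
        = 1 + l ^ 2 * (L + 2 * l) / L ^ 3 := by
      field_simp
      ring
    rw [this]
    have : 0 ≤ l ^ 2 * (L + 2 * l) / L ^ 3 :=
      div_nonneg (mul_nonneg (sq_nonneg _) (by linarith)) (by positivity)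
    linarith
  have h3 : 2 * l ^ 2 / L ^ 3 ≤ 50 * ρ ^ 2 / L ^ 3 :=
    div_le_div_of_nonneg_right (by linarith) (by positivity)
  have h4 : (s + ρ ^ 2 - s ^ 2 / 2) / L ^ 2 - 30 * ρ ^ 3 ≤ l / L ^ 2 := by
    have : ((s + ρ ^ 2 - s ^ 2 / 2) - 30 * ρ ^ 3) / L ^ 2 ≤ l / L ^ 2 := by
      gcongr
      linarith [(abs_le.1 h).1]
    rw [sub_div] at this
    have h9 : 30 * ρ ^ 3 / L ^ 2 ≤ 30 * ρ ^ 3 :=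
      div_le_self (by positivity) (by nlinarith)
    linarith
  linarith

variable {F : Type*} [NormedAddCommGroup F]

/-- The function `max 1 (log ‖x‖²)`. -/
noncomputable def logSq (x : F) : ℝ := max 1 (Real.log (‖x‖ ^ 2))

lemma one_le_logSq (x : F) : 1 ≤ logSq x := le_max_left _ _

lemma logSq_pos (x : F) : 0 < logSq x := one_pos.trans_le (one_le_logSq x)

lemma logSq_eq {x : F} (hx : 2 ≤ ‖x‖) : logSq x = Real.log (‖x‖ ^ 2) := by
  refine max_eq_right ?_
  rw [Real.le_log_iff_exp_le (by positivity)]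
  nlinarith [Real.exp_one_lt_d9]

lemma logSq_le {x : F} {K : ℝ} (hK : 2 ≤ K) (h : ‖x‖ ≤ K) : logSq x ≤ Real.log (K ^ 2) := by
  have h1 : 1 ≤ Real.log (K ^ 2) := by
    rw [Real.le_log_iff_exp_le (by positivity)]
    nlinarith [Real.exp_one_lt_d9]
  rcases le_or_gt (Real.log (‖x‖ ^ 2)) 1 with h2 | h2
  · rwa [logSq, max_eq_left h2]
  · refine max_le h1 (Real.log_le_log ?_ (by gcongr))
    by_contra h3
    have h4 : ‖x‖ ^ 2 = 0 := le_antisymm (not_lt.1 h3) (sq_nonneg _)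
    rw [h4, Real.log_zero] at h2
    linarith

lemma le_logSq {x : F} {K : ℝ} (hK : 0 < K) (h : K ≤ ‖x‖) : Real.log (K ^ 2) ≤ logSq x :=
  (Real.log_le_log (by positivity) (by gcongr)).trans (le_max_right _ _)

lemma measurable_logSq [MeasurableSpace F] [OpensMeasurableSpace F] :
    Measurable (logSq : F → ℝ) :=
  measurable_const.max (Real.measurable_log.comp (measurable_norm.pow_const 2))

lemma five_halves_le_logSq {x : F} (hx : 4 ≤ ‖x‖) : 5 / 2 ≤ logSq x := by
  rw [logSq_eq (by linarith), Real.le_log_iff_exp_le (by positivity)]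
  have h : Real.exp (5 / 2) ^ 2 ≤ (‖x‖ ^ 2) ^ 2 := by
    have h1 : Real.exp (5 / 2) ^ 2 = Real.exp 1 ^ 5 := by
      rw [← Real.exp_nat_mul, ← Real.exp_nat_mul]
      norm_num
    rw [h1]
    calc Real.exp 1 ^ 5 ≤ 2.7182818286 ^ 5 := by
          gcongr
          exact Real.exp_one_lt_d9.le
      _ ≤ (4 ^ 2) ^ 2 := by norm_num
      _ ≤ _ := by gcongr
  exact (sq_le_sq₀ (Real.exp_pos _).le (sq_nonneg _)).1 h

variable [InnerProductSpace ℝ F]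

lemma abs_two_mul_inner_div_le {x y : F} (hx : 0 < ‖x‖) :
    |2 * inner ℝ x y / ‖x‖ ^ 2| ≤ 2 * (‖y‖ / ‖x‖) := by
  rw [abs_div, abs_mul, abs_two, abs_of_pos (by positivity : 0 < ‖x‖ ^ 2),
    div_le_iff₀ (by positivity)]
  have : 2 * (‖y‖ / ‖x‖) * ‖x‖ ^ 2 = 2 * (‖x‖ * ‖y‖) := by field_simp
  rw [this]
  gcongr
  exact abs_real_inner_le_norm x y

lemma logSq_add_eq {x y : F} (hx : 4 ≤ ‖x‖) (hy : ‖y‖ / ‖x‖ ≤ 1 / 4) :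
    logSq (x + y) = logSq x
      + Real.log (1 + 2 * inner ℝ x y / ‖x‖ ^ 2 + (‖y‖ / ‖x‖) ^ 2) := by
  have hx0 : 0 < ‖x‖ := by linarith
  have hy' : ‖y‖ ≤ ‖x‖ / 4 := by
    rw [div_le_iff₀ hx0] at hy
    linarith
  have h2 : 2 ≤ ‖x + y‖ := by
    have : ‖x‖ ≤ ‖x + y‖ + ‖y‖ := by simpa using norm_sub_le (x + y) y
    linarith
  have h3 : 1 + 2 * inner ℝ x y / ‖x‖ ^ 2 + (‖y‖ / ‖x‖) ^ 2 = ‖x + y‖ ^ 2 / ‖x‖ ^ 2 := by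
    rw [norm_add_sq_real]
    field_simp
  rw [logSq_eq h2, logSq_eq (by linarith), h3, Real.log_div (by positivity) (by positivity)]
  ring

/-- The second-order Taylor polynomial, as a function of the increment `y`, of `log ‖x + y‖²`
at `x` (without the constant term). -/
noncomputable def logSqTaylor (x y : F) : ℝ :=
  2 * inner ℝ x y / ‖x‖ ^ 2 + (‖y‖ / ‖x‖) ^ 2 - (2 * inner ℝ x y / ‖x‖ ^ 2) ^ 2 / 2

lemma sq_le_mul_rpow {ρ q : ℝ} (hρ : 1 / 4 ≤ ρ) (hq2 : 2 < q) (hq3 : q ≤ 3) :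
    ρ ^ 2 ≤ 4 * ρ ^ q := by
  have hρ0 : 0 < ρ := by linarith
  have h1 : (1 / 4 : ℝ) ≤ ρ ^ (q - 2) := by
    calc (1 / 4 : ℝ) = (1 / 4 : ℝ) ^ (1 : ℝ) := by simp
      _ ≤ (1 / 4 : ℝ) ^ (q - 2) :=
        Real.rpow_le_rpow_of_exponent_ge (by norm_num) (by norm_num) (by linarith)
      _ ≤ ρ ^ (q - 2) := Real.rpow_le_rpow (by norm_num) hρ (by linarith)
  have h2 : ρ ^ q = ρ ^ 2 * ρ ^ (q - 2) := by
    rw [← Real.rpow_natCast ρ 2, ← Real.rpow_add hρ0]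
    congr 1
    push_cast
    ring
  rw [h2]
  nlinarith [sq_nonneg ρ]

lemma cube_le_rpow {ρ q : ℝ} (hρ0 : 0 ≤ ρ) (hρ : ρ ≤ 1) (hq2 : 2 < q) (hq3 : q ≤ 3) :
    ρ ^ 3 ≤ ρ ^ q := by
  rw [← Real.rpow_natCast ρ 3]
  rcases hρ0.eq_or_lt with rfl | h
  · rw [Real.zero_rpow (by norm_num), Real.zero_rpow (by linarith)]
  · exact Real.rpow_le_rpow_of_exponent_ge h hρ (by exact_mod_cast hq3)

/-- Global upper bound for the increment of `log logSq`. The remainder is of order larger than `2`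
in the increment, for large increments too. -/
lemma log_logSq_add_le {x y : F} {q : ℝ} (hx : 4 ≤ ‖x‖) (hq2 : 2 < q) (hq3 : q ≤ 3) :
    Real.log (logSq (x + y)) ≤ Real.log (logSq x) + logSqTaylor x y / logSq x
      - (2 * inner ℝ x y / ‖x‖ ^ 2) ^ 2 / (2 * logSq x ^ 2) + 500 * (‖y‖ / ‖x‖) ^ q := by
  have hx0 : 0 < ‖x‖ := by linarith
  have hs := abs_two_mul_inner_div_le (y := y) hx0
  have hL := five_halves_le_logSq hx
  rw [logSqTaylor]
  have hρ0 : 0 ≤ ‖y‖ / ‖x‖ := by positivity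
  rcases le_or_gt (‖y‖ / ‖x‖) (1 / 4) with h | h
  · rw [logSq_add_eq hx h]
    refine (log_add_log_le hρ0 h hs hL).trans ?_
    have := cube_le_rpow hρ0 (by linarith) hq2 hq3
    linarith
  · have hq := sq_le_mul_rpow h.le hq2 hq3
    set ρ := ‖y‖ / ‖x‖ with hρ
    set s := 2 * inner ℝ x y / ‖x‖ ^ 2
    have hL0 : 0 < logSq x := logSq_pos x
    have h1 : logSq (x + y) ≤ logSq x + 2 * ρ := by
      refine max_le (by linarith) ?_
      rcases eq_or_ne (x + y) 0 with h0 | h0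
      · rw [h0]
        simp
        linarith
      have h0' : 0 < ‖x + y‖ := norm_pos_iff.2 h0
      have h2 : ‖x + y‖ ≤ ‖x‖ * (1 + ρ) := by
        refine (norm_add_le x y).trans ?_
        rw [hρ]
        apply le_of_eq
        field_simp
      rw [logSq_eq (by linarith), Real.log_pow, Real.log_pow]
      have h3 := Real.log_le_log h0' h2
      rw [Real.log_mul hx0.ne' (by linarith)] at h3
      have h4 := Real.log_le_sub_one_of_pos (by linarith : 0 < 1 + ρ)
      push_cast
      linarith
    have h2 : Real.log (logSq (x + y)) ≤ Real.log (logSq x) + 2 * ρ := by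
      refine (Real.log_le_log (logSq_pos _) h1).trans ?_
      have h3 : logSq x + 2 * ρ = logSq x * (1 + 2 * ρ / logSq x) := by field_simp
      have h5 : 0 ≤ 2 * ρ / logSq x := by positivity
      rw [h3, Real.log_mul hL0.ne' (by linarith)]
      have h4 := Real.log_le_sub_one_of_pos (by linarith : 0 < 1 + 2 * ρ / logSq x)
      have h6 : 2 * ρ / logSq x ≤ 2 * ρ := div_le_self (by linarith) (by linarith)
      linarith
    have hs2 : s ^ 2 ≤ 4 * ρ ^ 2 := by
      have := sq_le_sq' (abs_le.1 hs).1 (abs_le.1 hs).2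
      linarith
    have h7 : -(2 * ρ + 2 * ρ ^ 2) ≤ (s + ρ ^ 2 - s ^ 2 / 2) / logSq x := by
      rw [le_div_iff₀ hL0]
      nlinarith [(abs_le.1 hs).1, sq_nonneg ρ]
    have h8 : s ^ 2 / (2 * logSq x ^ 2) ≤ 4 * ρ ^ 2 :=
      (div_le_self (sq_nonneg _) (by nlinarith)).trans hs2
    nlinarith

/-- Global upper bound for the increment of `1 / logSq`. -/
lemma inv_logSq_add_le {x y : F} {q : ℝ} (hx : 4 ≤ ‖x‖) (hq2 : 2 < q) (hq3 : q ≤ 3) :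
    (logSq (x + y))⁻¹ ≤ (logSq x)⁻¹ - logSqTaylor x y / logSq x ^ 2
      + 50 * (‖y‖ / ‖x‖) ^ 2 / logSq x ^ 3 + 500 * (‖y‖ / ‖x‖) ^ q := by
  have hx0 : 0 < ‖x‖ := by linarith
  have hs := abs_two_mul_inner_div_le (y := y) hx0
  have hL := five_halves_le_logSq hx
  rw [logSqTaylor]
  have hρ0 : 0 ≤ ‖y‖ / ‖x‖ := by positivity
  rcases le_or_gt (‖y‖ / ‖x‖) (1 / 4) with h | h
  · rw [logSq_add_eq hx h]
    refine (inv_add_log_le hρ0 h hs hL).trans ?_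
    have := cube_le_rpow hρ0 (by linarith) hq2 hq3
    linarith
  · have hq := sq_le_mul_rpow h.le hq2 hq3
    set ρ := ‖y‖ / ‖x‖ with hρ
    set s := 2 * inner ℝ x y / ‖x‖ ^ 2
    have hL0 : 0 < logSq x := logSq_pos x
    have h1 : (logSq (x + y))⁻¹ ≤ 1 := inv_le_one_of_one_le₀ (one_le_logSq _)
    have h2 : 0 ≤ (logSq x)⁻¹ := by positivity
    have h7 : (s + ρ ^ 2 - s ^ 2 / 2) / logSq x ^ 2 ≤ 2 * ρ + ρ ^ 2 := by
      rw [div_le_iff₀ (by positivity)]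
      have : 1 ≤ logSq x ^ 2 := by nlinarith
      nlinarith [(abs_le.1 hs).2, sq_nonneg s, sq_nonneg ρ]
    have h8 : 0 ≤ 50 * ρ ^ 2 / logSq x ^ 3 := by positivity
    nlinarith

/-- Global upper bound for the increment of the truncated quadratic function `(B² - ‖x‖²)⁺`. -/
lemma max_sub_norm_add_sq_le {x y : F} {q D : ℝ} (hq2 : 2 < q) (hD : 0 < D) (hx : ‖x‖ ≤ D) :
    max 0 ((2 * D) ^ 2 - ‖x + y‖ ^ 2) ≤ (2 * D) ^ 2 - ‖x‖ ^ 2 - 2 * inner ℝ x y - ‖y‖ ^ 2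
      + 4 * D ^ (2 - q) * ‖y‖ ^ q := by
  -- the left side differs from its quadratic part only if `‖x + y‖ > 2 D`, and then `‖y‖ ≥ D`
  have h0 : 0 ≤ 4 * D ^ (2 - q) * ‖y‖ ^ q := by positivity
  have h1 := norm_add_sq_real x y
  refine max_le ?_ (by linarith)
  rcases le_or_gt (‖x + y‖) (2 * D) with h | h
  · nlinarith [norm_nonneg (x + y)]
  · have h2 := norm_add_le x y
    have hy : D ≤ ‖y‖ := by linarith
    have hy0 : 0 < ‖y‖ := by linarith
    have h3 : ‖y‖ ^ 2 ≤ D ^ (2 - q) * ‖y‖ ^ q := by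
      have h4 : ‖y‖ ^ (2 - q) ≤ D ^ (2 - q) :=
        Real.rpow_le_rpow_of_nonpos hD hy (by linarith)
      calc ‖y‖ ^ 2 = ‖y‖ ^ (2 - q) * ‖y‖ ^ q := by
            rw [← Real.rpow_add hy0]
            norm_num
        _ ≤ _ := by gcongr
    have h5 : ‖x + y‖ ^ 2 ≤ (2 * ‖y‖) ^ 2 := by
      gcongr
      linarith
    nlinarith

end Pointwise

/-! ### Moments of the increments -/

section Moments

variable {d : ℕ} {𝕏 : Set (E d)} {P : Kernel 𝕏 𝕏}

/-- The exponent in the moment bound may be lowered to some `q ∈ (2, 3]`. -/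
lemma BoundedMoments.exists_le_three [IsMarkovKernel P] (hA0 : BoundedMoments P) :
    ∃ q C : ℝ, 2 < q ∧ q ≤ 3 ∧ 0 ≤ C ∧ ∀ x : 𝕏,
      MemLp (fun y : 𝕏 => (y : E d) - x) 2 (P x) ∧
      Integrable (fun y : 𝕏 => ‖(y : E d) - x‖ ^ q) (P x) ∧
      ∫ y, ‖(y : E d) - x‖ ^ q ∂(P x) ≤ C := by
  obtain ⟨p, hp, hM⟩ := hA0
  set M := ⨆ x : 𝕏, ∫⁻ y, ‖(y : E d) - (x : E d)‖ₑ ^ p ∂(P x) with hMdef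
  have hp0 : 0 < p := by linarith
  refine ⟨min p 3, 1 + M.toReal, lt_min hp (by norm_num), min_le_right _ _, by positivity,
    fun x => ?_⟩
  set q := min p 3
  have hq0 : 0 < q := lt_min hp0 (by norm_num)
  have hqp : q ≤ p := min_le_left _ _
  have hmeas : AEStronglyMeasurable (fun y : 𝕏 => (y : E d) - x) (P x) :=
    (measurable_subtype_coe.sub_const _).aestronglyMeasurable
  have hle : ∫⁻ y, ‖(y : E d) - (x : E d)‖ₑ ^ p ∂(P x) ≤ M :=
    le_iSup (fun x : 𝕏 => ∫⁻ y, ‖(y : E d) - (x : E d)‖ₑ ^ p ∂(P x)) x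
  have hLp : MemLp (fun y : 𝕏 => (y : E d) - x) (ENNReal.ofReal p) (P x) := by
    refine ⟨hmeas, ?_⟩
    rw [eLpNorm_lt_top_iff_lintegral_rpow_enorm_lt_top (by simpa using hp0) ENNReal.ofReal_ne_top,
      ENNReal.toReal_ofReal hp0.le]
    exact hle.trans_lt hM
  have hLq : MemLp (fun y : 𝕏 => (y : E d) - x) (ENNReal.ofReal q) (P x) :=
    hLp.mono_exponent (ENNReal.ofReal_le_ofReal hqp)
  have hip : Integrable (fun y : 𝕏 => ‖(y : E d) - x‖ ^ p) (P x) := by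
    have := hLp.integrable_norm_rpow (by simpa using hp0) ENNReal.ofReal_ne_top
    rwa [ENNReal.toReal_ofReal hp0.le] at this
  have hiq : Integrable (fun y : 𝕏 => ‖(y : E d) - x‖ ^ q) (P x) := by
    have := hLq.integrable_norm_rpow (by simpa using hq0) ENNReal.ofReal_ne_top
    rwa [ENNReal.toReal_ofReal hq0.le] at this
  refine ⟨hLp.mono_exponent ?_, hiq, ?_⟩
  · rw [← ENNReal.ofReal_ofNat]
    exact ENNReal.ofReal_le_ofReal hp.le
  calc ∫ y, ‖(y : E d) - x‖ ^ q ∂(P x)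
      ≤ ∫ y, (1 + ‖(y : E d) - x‖ ^ p) ∂(P x) := by
        refine integral_mono hiq ((integrable_const 1).add hip) fun y => ?_
        rcases le_total ‖(y : E d) - x‖ 1 with h | h
        · have h1 := Real.rpow_le_one (norm_nonneg _) h hq0.le
          have h2 := Real.rpow_nonneg (norm_nonneg ((y : E d) - x)) p
          simp only
          linarith
        · have h1 := Real.rpow_le_rpow_of_exponent_le h hqp
          simp only
          linarith
    _ = 1 + ∫ y, ‖(y : E d) - x‖ ^ p ∂(P x) := by
        rw [integral_add (integrable_const 1) hip]
        simp
    _ ≤ 1 + M.toReal := by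
        gcongr
        rw [integral_eq_lintegral_of_nonneg_ae (Eventually.of_forall fun y => by positivity)
          hip.aestronglyMeasurable]
        refine ENNReal.toReal_mono hM.ne (le_trans (le_of_eq ?_) hle)
        refine lintegral_congr fun y => ?_
        rw [← ENNReal.ofReal_rpow_of_nonneg (norm_nonneg _) hp0.le, ofReal_norm]

variable {x : 𝕏}

lemma memLp_coord (h2 : MemLp (fun y : 𝕏 => (y : E d) - x) 2 (P x)) (i : Fin d) :
    MemLp (fun y : 𝕏 => ((y : E d) - x) i) 2 (P x) :=
  (EuclideanSpace.proj (𝕜 := ℝ) i).comp_memLp' h2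

lemma integral_norm_sq_eq_trace (h2 : MemLp (fun y : 𝕏 => (y : E d) - x) 2 (P x)) :
    ∫ y, ‖(y : E d) - x‖ ^ 2 ∂(P x) = (covMatrix P x).trace := by
  simp only [EuclideanSpace.real_norm_sq_eq, Matrix.trace, Matrix.diag, covMatrix, Matrix.of_apply]
  rw [integral_finsetSum _ fun i _ => (memLp_coord h2 i).integrable_sq]
  simp only [sq]

lemma integral_inner_sq_eq (h2 : MemLp (fun y : 𝕏 => (y : E d) - x) 2 (P x)) (u : E d) :
    ∫ y, (inner ℝ u ((y : E d) - x)) ^ 2 ∂(P x)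
      = inner ℝ u (Matrix.toEuclideanCLM (n := Fin d) (𝕜 := ℝ) (covMatrix P x) u) := by
  have hint : ∀ i j, Integrable (fun y : 𝕏 => ((y : E d) - x) i * ((y : E d) - x) j) (P x) :=
    fun i j => (memLp_coord h2 i).integrable_mul (memLp_coord h2 j)
  have h : ∀ y : 𝕏, (inner ℝ u ((y : E d) - x)) ^ 2
      = ∑ i, ∑ j, u i * u j * (((y : E d) - x) i * ((y : E d) - x) j) := by
    intro y
    rw [sq, PiLp.inner_apply, Finset.sum_mul_sum]
    refine Finset.sum_congr rfl fun i _ => Finset.sum_congr rfl fun j _ => ?_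
    simp only [RCLike.inner_apply, conj_trivial]
    ring
  simp only [h]
  rw [Matrix.inner_toEuclideanCLM,
    integral_finsetSum _ fun i _ => integrable_finsetSum _ fun j _ => (hint i j).const_mul _]
  simp only [dotProduct, Matrix.mulVec, Finset.mul_sum]
  refine Finset.sum_congr rfl fun i _ => ?_
  rw [integral_finsetSum _ fun j _ => (hint i j).const_mul _]
  refine Finset.sum_congr rfl fun j _ => ?_
  rw [integral_const_mul, covMatrix, Matrix.of_apply]
  ring

lemma integral_inner_eq_zero [IsMarkovKernel P] (hA1 : ZeroDrift P)
    (h2 : MemLp (fun y : 𝕏 => (y : E d) - x) 2 (P x)) (u : E d) :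
    ∫ y, inner ℝ u ((y : E d) - x) ∂(P x) = 0 := by
  rw [integral_inner (h2.integrable one_le_two) u]
  have := hA1 x
  rw [drift] at this
  rw [this, inner_zero_right]

/-- If `W` is dominated by a quadratic function of the increment plus a multiple of the power `q`
of its norm, its mean after one step is at most what the moments give. The term `h` is added on both
sides because `ENNReal.ofReal` truncates. -/
lemma lintegral_ofReal_le [IsMarkovKernel P] (hA1 : ZeroDrift P) {q C : ℝ}
    (h2 : MemLp (fun y : 𝕏 => (y : E d) - x) 2 (P x))
    (hq : Integrable (fun y : 𝕏 => ‖(y : E d) - x‖ ^ q) (P x))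
    (hC : ∫ y, ‖(y : E d) - x‖ ^ q ∂(P x) ≤ C)
    {W : 𝕏 → ℝ} (hW0 : ∀ y, 0 ≤ W y) {a b₁ b₂ b₃ b₄ h : ℝ} (hb₄ : 0 ≤ b₄) (hh : 0 ≤ h)
    (hW : ∀ y : 𝕏, W y ≤ a + b₁ * inner ℝ (x : E d) ((y : E d) - x)
      + b₂ * ‖(y : E d) - x‖ ^ 2 + b₃ * (inner ℝ (x : E d) ((y : E d) - x)) ^ 2
      + b₄ * ‖(y : E d) - x‖ ^ q) :
    ∫⁻ y, ENNReal.ofReal (W y) ∂(P x) + ENNReal.ofReal h ≤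
      ENNReal.ofReal (a + b₂ * (covMatrix P x).trace + b₃ * inner ℝ (x : E d)
          (Matrix.toEuclideanCLM (n := Fin d) (𝕜 := ℝ) (covMatrix P x) (x : E d))
      + b₄ * C + h) := by
  have i1 : Integrable (fun y : 𝕏 => inner ℝ (x : E d) ((y : E d) - x)) (P x) :=
    (h2.integrable one_le_two).const_inner _
  have i2 : Integrable (fun y : 𝕏 => ‖(y : E d) - x‖ ^ 2) (P x) :=
    h2.integrable_norm_pow two_ne_zero
  have i3 : Integrable (fun y : 𝕏 => (inner ℝ (x : E d) ((y : E d) - x)) ^ 2) (P x) :=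
    (h2.const_inner (𝕜 := ℝ) (x : E d)).integrable_sq
  have j1 : Integrable (fun y : 𝕏 => a + b₁ * inner ℝ (x : E d) ((y : E d) - x)) (P x) :=
    (integrable_const a).add (i1.const_mul b₁)
  have j2 := j1.add (i2.const_mul b₂)
  have j3 := j2.add (i3.const_mul b₃)
  have j4 := j3.add (hq.const_mul b₄)
  have h0 := fun y => (hW0 y).trans (hW y)
  calc _ ≤ ∫⁻ y, ENNReal.ofReal (a + b₁ * inner ℝ (x : E d) ((y : E d) - x)
          + b₂ * ‖(y : E d) - x‖ ^ 2 + b₃ * (inner ℝ (x : E d) ((y : E d) - x)) ^ 2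
          + b₄ * ‖(y : E d) - x‖ ^ q) ∂(P x) + ENNReal.ofReal h := by
        gcongr with y
        exact hW y
    _ = ENNReal.ofReal (∫ y, (a + b₁ * inner ℝ (x : E d) ((y : E d) - x)
          + b₂ * ‖(y : E d) - x‖ ^ 2 + b₃ * (inner ℝ (x : E d) ((y : E d) - x)) ^ 2
          + b₄ * ‖(y : E d) - x‖ ^ q) ∂(P x) + h) := by
        rw [ENNReal.ofReal_add (integral_nonneg h0) hh]
        exact congrArg (· + ENNReal.ofReal h)
          (ofReal_integral_eq_lintegral_ofReal j4 (Eventually.of_forall h0)).symm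
    _ ≤ _ := by
        refine ENNReal.ofReal_le_ofReal ?_
        have e4 := integral_add j3 (hq.const_mul b₄)
        have e3 := integral_add j2 (i3.const_mul b₃)
        have e2 := integral_add j1 (i2.const_mul b₂)
        have e1 := integral_add (integrable_const a) (i1.const_mul b₁)
        simp only [Pi.add_apply, integral_const_mul] at e1 e2 e3 e4
        rw [e4, e3, e2, e1, integral_norm_sq_eq_trace h2, integral_inner_sq_eq h2,
          integral_inner_eq_zero hA1 h2]
        have := mul_le_mul_of_nonneg_left hC hb₄
        simp
        exact this

lemma abs_trace_le (A : Matrix (Fin d) (Fin d) ℝ) :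
    |A.trace| ≤ d * ‖Matrix.toEuclideanCLM (n := Fin d) (𝕜 := ℝ) A‖ := by
  have h : ∀ i, |A i i| ≤ ‖Matrix.toEuclideanCLM (n := Fin d) (𝕜 := ℝ) A‖ := by
    intro i
    have h1 : A i i = inner ℝ (EuclideanSpace.single i (1 : ℝ))
        (Matrix.toEuclideanCLM (n := Fin d) (𝕜 := ℝ) A (EuclideanSpace.single i 1)) := by
      rw [EuclideanSpace.inner_single_left, Matrix.ofLp_toEuclideanCLM]
      simp
    rw [h1]
    refine (abs_real_inner_le_norm _ _).trans ?_
    have h2 := (Matrix.toEuclideanCLM (n := Fin d) (𝕜 := ℝ) A).le_opNorm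
      (EuclideanSpace.single i 1)
    simpa using h2
  calc |A.trace| ≤ ∑ i, |A i i| := Finset.abs_sum_le_sum_abs _ _
    _ ≤ ∑ _i : Fin d, ‖Matrix.toEuclideanCLM (n := Fin d) (𝕜 := ℝ) A‖ :=
        Finset.sum_le_sum fun i _ => h i
    _ = _ := by simp

/-- The trace and the radial part of `M(x)` are within multiples of `e` of `V` and `U`, when `e`
bounds the covariance error. -/
lemma abs_trace_sub_le_and_abs_inner_sub_le [NeZero d] {σsq : S d → Matrix (Fin d) (Fin d) ℝ}
    {U V : ℝ} (hA4 : CovForm σsq U V) {e : ℝ} (he : 0 ≤ e)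
    (hcov : covError P σsq ‖(x : E d)‖ ≤ ENNReal.ofReal e) (hx : 0 < ‖(x : E d)‖) :
    |(covMatrix P x).trace - V| ≤ d * e ∧
    |inner ℝ (x : E d) (Matrix.toEuclideanCLM (n := Fin d) (𝕜 := ℝ) (covMatrix P x) (x : E d))
      - ‖(x : E d)‖ ^ 2 * U| ≤ ‖(x : E d)‖ ^ 2 * e := by
  set r := ‖(x : E d)‖ with hr
  obtain ⟨h1, h2⟩ := hA4.2.2 (dir (x : E d))
  set A := covMatrix P x - σsq (dir (x : E d)) with hAdef
  have hA : ‖Matrix.toEuclideanCLM (n := Fin d) (𝕜 := ℝ) A‖ ≤ e := by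
    have h3 : ‖Matrix.toEuclideanCLM (n := Fin d) (𝕜 := ℝ) A‖ₑ ≤ covError P σsq r :=
      le_iSup₂_of_le (f := fun (x : 𝕏) (_ : r ≤ ‖(x : E d)‖) =>
        ‖Matrix.toEuclideanCLM (n := Fin d) (𝕜 := ℝ) (covMatrix P x - σsq (dir (x : E d)))‖ₑ)
        x le_rfl le_rfl
    rw [← ofReal_norm] at h3
    exact (ENNReal.ofReal_le_ofReal_iff he).1 (h3.trans hcov)
  constructor
  · rw [← h2, ← Matrix.trace_sub]
    exact (abs_trace_le A).trans (by gcongr)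
  · have hu : ((dir (x : E d) : S d) : E d) = r⁻¹ • (x : E d) := by
      have : (x : E d) ≠ 0 := norm_pos_iff.1 hx
      simp [dir, this, hr]
    have hxu : (x : E d) = r • ((dir (x : E d) : S d) : E d) := by
      rw [hu, smul_smul, mul_inv_cancel₀ hx.ne', one_smul]
    have h3 : r ^ 2 * U = inner ℝ (x : E d)
        (Matrix.toEuclideanCLM (n := Fin d) (𝕜 := ℝ) (σsq (dir (x : E d))) (x : E d)) := by
      have key : ∀ (B : E d →L[ℝ] E d) (z w : E d), z = r • w →
          inner ℝ z (B z) = r ^ 2 * inner ℝ w (B w) := by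
        rintro B z w rfl
        rw [map_smul, real_inner_smul_left, real_inner_smul_right]
        ring
      rw [key _ _ _ hxu, h1]
    rw [h3, ← inner_sub_right, ← sub_apply, ← map_sub]
    refine (abs_real_inner_le_norm _ _).trans ?_
    have h4 := (Matrix.toEuclideanCLM (n := Fin d) (𝕜 := ℝ) A).le_opNorm (x : E d)
    calc _ ≤ r * (‖Matrix.toEuclideanCLM (n := Fin d) (𝕜 := ℝ) A‖ * r) := by gcongr
      _ ≤ r * (e * r) := by gcongr
      _ = _ := by ring

end Moments

/-! ### Drift conditions -/

section Drift

variable {d : ℕ} {𝕏 : Set (E d)} {P : Kernel 𝕏 𝕏}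

lemma tendsto_log_sq_atTop : Tendsto (fun r : ℝ => Real.log (r ^ 2)) atTop atTop :=
  Real.tendsto_log_atTop.comp (tendsto_pow_atTop two_ne_zero)

/-- `log (r²)` grows more slowly than every positive power of `r`. -/
lemma tendsto_log_sq_pow_mul_rpow {δ : ℝ} (hδ : 0 < δ) (n : ℕ) :
    Tendsto (fun r : ℝ => Real.log (r ^ 2) ^ n * r ^ (-δ)) atTop (𝓝 0) := by
  have h := (isLittleO_log_rpow_rpow_atTop (n : ℝ) hδ).tendsto_div_nhds_zero.const_mul (2 ^ n)
  rw [mul_zero] at h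
  refine h.congr' ?_
  filter_upwards [eventually_gt_atTop 0] with r hr
  rw [Real.rpow_natCast, Real.rpow_neg hr.le, Real.log_pow, div_eq_mul_inv]
  push_cast
  ring

/-- In the case `2U < V`, the function `1 / logSq` does not increase in the mean far from the
origin. -/
lemma exists_lintegral_inv_logSq_le [NeZero d] [IsMarkovKernel P] (hA0 : BoundedMoments P)
    (hA1 : ZeroDrift P) {σsq : S d → Matrix (Fin d) (Fin d) ℝ} (hA3 : CovLimit P σsq)
    {U V : ℝ} (hA4 : CovForm σsq U V) (hUV : 2 * U < V) :
    ∃ R : ℝ, ∀ x : 𝕏, R ≤ ‖(x : E d)‖ →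
      ∫⁻ y, ENNReal.ofReal (logSq (y : E d))⁻¹ ∂(P x) ≤ ENNReal.ofReal (logSq (x : E d))⁻¹ := by
  obtain ⟨q, C, hq2, hq3, hC0, hmom⟩ := hA0.exists_le_three
  set κ := V - 2 * U with hκ
  have hκ0 : 0 < κ := by linarith
  set e := κ / (4 * (d + 2)) with he
  have he0 : 0 < e := by positivity
  have hde : (d + 2) * e = κ / 4 := by
    rw [he]
    field_simp
  have ev1 : ∀ᶠ r in atTop, covError P σsq r ≤ ENNReal.ofReal e :=
    hA3.2.eventually_le_const (by simpa using he0)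
  have ev2 : ∀ᶠ r : ℝ in atTop, 200 * (V + d * e) / κ ≤ Real.log (r ^ 2) :=
    tendsto_log_sq_atTop.eventually_ge_atTop _
  have ev3 : ∀ᶠ r : ℝ in atTop, 500 * C * (Real.log (r ^ 2) ^ 2 * r ^ (-(q - 2))) ≤ κ / 4 := by
    have := (tendsto_log_sq_pow_mul_rpow (sub_pos.2 hq2) 2).const_mul (500 * C)
    exact this.eventually_le_const (by simpa using (by positivity : 0 < κ / 4))
  obtain ⟨R, hR⟩ := eventually_atTop.1 ((ev1.and (ev2.and ev3)).and (eventually_ge_atTop 4))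
  refine ⟨R, fun x hx => ?_⟩
  obtain ⟨⟨hr1, hr2, hr3⟩, hr4⟩ := hR _ hx
  obtain ⟨h2, hiq, hC⟩ := hmom x
  have hr0 : 0 < ‖(x : E d)‖ := by linarith
  obtain ⟨ht, hi⟩ := abs_trace_sub_le_and_abs_inner_sub_le hA4 he0.le hr1 hr0
  rw [← logSq_eq (by linarith : 2 ≤ ‖(x : E d)‖)] at hr2 hr3
  have hL0 := logSq_pos (x : E d)
  set r := ‖(x : E d)‖ with hr
  set L := logSq (x : E d) with hL
  suffices H : ∫⁻ y, ENNReal.ofReal (logSq (y : E d))⁻¹ ∂(P x) + ENNReal.ofReal 0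
      ≤ ENNReal.ofReal L⁻¹ by
    rwa [ENNReal.ofReal_zero, add_zero] at H
  refine (lintegral_ofReal_le hA1 h2 hiq hC (fun y => by have := logSq_pos (y : E d); positivity)
    (a := L⁻¹) (b₁ := -(2 / (r ^ 2 * L ^ 2))) (b₂ := (50 / L - 1) / (r ^ 2 * L ^ 2))
    (b₃ := 2 / (r ^ 4 * L ^ 2)) (b₄ := 500 / r ^ q) (h := 0) (by positivity) le_rfl
    fun y => ?_).trans ?_
  · have := inv_logSq_add_le (y := (y : E d) - x) hr4 hq2 hq3
    rw [add_sub_cancel] at this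
    refine this.trans (le_of_eq ?_)
    rw [logSqTaylor, Real.div_rpow (norm_nonneg _) hr0.le]
    simp only [← hr, ← hL]
    field_simp
    ring
  · refine ENNReal.ofReal_le_ofReal ?_
    set t := (covMatrix P x).trace
    set I := inner ℝ (x : E d)
      (Matrix.toEuclideanCLM (n := Fin d) (𝕜 := ℝ) (covMatrix P x) (x : E d))
    have ht1 := abs_le.1 ht
    have hi1 : I ≤ r ^ 2 * (U + e) := by linarith [(abs_le.1 hi).2]
    have hrq : r ^ (-(q - 2)) = r ^ 2 / r ^ q := by
      rw [neg_sub, Real.rpow_sub hr0, Real.rpow_ofNat]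
    rw [hrq] at hr3
    -- the total drift, multiplied by `r² L²`
    have hsum : L⁻¹ + (50 / L - 1) / (r ^ 2 * L ^ 2) * t + 2 / (r ^ 4 * L ^ 2) * I
        + 500 / r ^ q * C + 0 = L⁻¹ + (50 * t / L - t + 2 * (I / r ^ 2)
          + 500 * C * (L ^ 2 * (r ^ 2 / r ^ q))) / (r ^ 2 * L ^ 2) := by
      field_simp
      ring
    rw [hsum]
    have h5 : I / r ^ 2 ≤ U + e := by
      rw [div_le_iff₀ (by positivity)]
      linarith
    have h6 : 50 * t / L ≤ κ / 4 := by
      rw [div_le_iff₀ hκ0] at hr2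
      rw [div_le_iff₀ hL0]
      linarith [ht1.2]
    have h7 : (50 * t / L - t + 2 * (I / r ^ 2)
          + 500 * C * (L ^ 2 * (r ^ 2 / r ^ q))) / (r ^ 2 * L ^ 2) ≤ 0 :=
      div_nonpos_of_nonpos_of_nonneg (by linarith [ht1.1]) (by positivity)
    linarith

/-- If the covariance error is small compared with the distance of `2U` from `V`, or compared with
`1 / log r`, then the mean of `log logSq` decreases strictly far from the origin. -/
lemma exists_lintegral_log_logSq_le [NeZero d] [IsMarkovKernel P] (hA0 : BoundedMoments P)
    (hA1 : ZeroDrift P) {σsq : S d → Matrix (Fin d) (Fin d) ℝ}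
    {U V : ℝ} (hA4 : CovForm σsq U V)
    (hε : ∀ᶠ r in atTop, ∃ e : ℝ, 0 ≤ e ∧ e ≤ U / 4 ∧ covError P σsq r ≤ ENNReal.ofReal e ∧
      (V - 2 * U + (d + 2) * e) * Real.log (r ^ 2) ≤ U / 2) :
    ∃ R : ℝ, 4 ≤ R ∧ ∀ x : 𝕏, R ≤ ‖(x : E d)‖ →
      ∫⁻ y, ENNReal.ofReal (Real.log (logSq (y : E d))) ∂(P x)
        + ENNReal.ofReal (U / (2 * (‖(x : E d)‖ ^ 2 * logSq (x : E d) ^ 2)))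
        ≤ ENNReal.ofReal (Real.log (logSq (x : E d))) := by
  obtain ⟨q, C, hq2, hq3, hC0, hmom⟩ := hA0.exists_le_three
  have hU := hA4.1
  have ev3 : ∀ᶠ r : ℝ in atTop, 500 * C * (Real.log (r ^ 2) ^ 2 * r ^ (-(q - 2))) ≤ U / 4 := by
    have := (tendsto_log_sq_pow_mul_rpow (sub_pos.2 hq2) 2).const_mul (500 * C)
    exact this.eventually_le_const (by simpa using (by positivity : 0 < U / 4))
  obtain ⟨R, hR⟩ := eventually_atTop.1 ((hε.and ev3).and (eventually_ge_atTop 4))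
  refine ⟨R, (hR R le_rfl).2, fun x hx => ?_⟩
  obtain ⟨⟨⟨e, he0, heU, hr1, hr2⟩, hr3⟩, hr4⟩ := hR _ hx
  obtain ⟨h2, hiq, hC⟩ := hmom x
  have hr0 : 0 < ‖(x : E d)‖ := by linarith
  obtain ⟨ht, hi⟩ := abs_trace_sub_le_and_abs_inner_sub_le hA4 he0 hr1 hr0
  rw [← logSq_eq (by linarith : 2 ≤ ‖(x : E d)‖)] at hr2 hr3
  have hL0 := logSq_pos (x : E d)
  set r := ‖(x : E d)‖ with hr
  set L := logSq (x : E d) with hL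
  set t := (covMatrix P x).trace
  set I := inner ℝ (x : E d)
    (Matrix.toEuclideanCLM (n := Fin d) (𝕜 := ℝ) (covMatrix P x) (x : E d))
  have hW := lintegral_ofReal_le hA1 h2 hiq hC
    (W := fun y : 𝕏 => Real.log (logSq (y : E d)))
    (fun y => Real.log_nonneg (one_le_logSq _))
    (a := Real.log L) (b₁ := 2 / (r ^ 2 * L)) (b₂ := 1 / (r ^ 2 * L))
    (b₃ := -(2 / (r ^ 4 * L)) - 2 / (r ^ 4 * L ^ 2)) (b₄ := 500 / r ^ q)
    (h := U / (2 * (r ^ 2 * L ^ 2))) (by positivity) (by positivity) fun y => by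
      have := log_logSq_add_le (y := (y : E d) - x) hr4 hq2 hq3
      rw [add_sub_cancel] at this
      refine this.trans (le_of_eq ?_)
      rw [logSqTaylor, Real.div_rpow (norm_nonneg _) hr0.le]
      simp only [← hr, ← hL]
      field_simp
      ring
  refine hW.trans (ENNReal.ofReal_le_ofReal ?_)
  have ht1 := abs_le.1 ht
  have hi1 : r ^ 2 * (U - e) ≤ I := by linarith [(abs_le.1 hi).1]
  have hrq : r ^ (-(q - 2)) = r ^ 2 / r ^ q := by
    rw [neg_sub, Real.rpow_sub hr0, Real.rpow_ofNat]
  rw [hrq] at hr3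
  -- the total drift, multiplied by `r² L²`
  have hsum : Real.log L + 1 / (r ^ 2 * L) * t + (-(2 / (r ^ 4 * L)) - 2 / (r ^ 4 * L ^ 2)) * I
      + 500 / r ^ q * C = Real.log L + ((t - 2 * (I / r ^ 2)) * L - 2 * (I / r ^ 2)
        + 500 * C * (L ^ 2 * (r ^ 2 / r ^ q))) / (r ^ 2 * L ^ 2) := by
    field_simp
    ring
  rw [hsum]
  have h5 : U - e ≤ I / r ^ 2 := by
    rw [le_div_iff₀ (by positivity)]
    linarith
  have h6 : (t - 2 * (I / r ^ 2)) * L ≤ (V - 2 * U + (d + 2) * e) * L := by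
    gcongr
    linarith [ht1.2]
  have h7 : ((t - 2 * (I / r ^ 2)) * L - 2 * (I / r ^ 2)
      + 500 * C * (L ^ 2 * (r ^ 2 / r ^ q))) / (r ^ 2 * L ^ 2)
      ≤ -(U / (2 * (r ^ 2 * L ^ 2))) := by
    rw [show -(U / (2 * (r ^ 2 * L ^ 2))) = -(U / 2) / (r ^ 2 * L ^ 2) by field_simp]
    exact div_le_div_of_nonneg_right (by linarith) (by positivity)
  linarith

/-- On every ball, some truncated quadratic function decreases in the mean by a fixed amount. -/
lemma exists_lintegral_max_sub_sq_le [IsMarkovKernel P] (hA0 : BoundedMoments P)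
    (hA1 : ZeroDrift P) (hA2 : UniformlyNondegenerate P) (K : ℝ) :
    ∃ D v : ℝ, 0 < v ∧ ∀ x : 𝕏, ‖(x : E d)‖ ≤ K →
      ∫⁻ y, ENNReal.ofReal (max 0 ((2 * D) ^ 2 - ‖(y : E d)‖ ^ 2)) ∂(P x) + ENNReal.ofReal v
        ≤ ENNReal.ofReal (max 0 ((2 * D) ^ 2 - ‖(x : E d)‖ ^ 2)) := by
  obtain ⟨q, C, hq2, hq3, hC0, hmom⟩ := hA0.exists_le_three
  obtain ⟨v, hv, hA2⟩ := hA2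
  have ev1 : ∀ᶠ D : ℝ in atTop, 4 * C * D ^ (-(q - 2)) ≤ v / 2 := by
    have := (tendsto_rpow_neg_atTop (sub_pos.2 hq2)).const_mul (4 * C)
    exact this.eventually_le_const (by simpa using (by positivity : 0 < v / 2))
  obtain ⟨D, hD1, hDK, hD0⟩ :=
    (ev1.and ((eventually_ge_atTop K).and (eventually_gt_atTop 0))).exists
  refine ⟨D, v / 2, by positivity, fun x hx => ?_⟩
  obtain ⟨h2, hiq, hC⟩ := hmom x
  refine (lintegral_ofReal_le hA1 h2 hiq hC (fun y => le_max_left _ _)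
    (a := (2 * D) ^ 2 - ‖(x : E d)‖ ^ 2) (b₁ := -2) (b₂ := -1) (b₃ := 0)
    (b₄ := 4 * D ^ (2 - q)) (h := v / 2) (by positivity) (by positivity) fun y => ?_).trans ?_
  · have := max_sub_norm_add_sq_le (y := (y : E d) - x) hq2 hD0 (hx.trans hDK)
    rw [add_sub_cancel] at this
    linarith
  · refine ENNReal.ofReal_le_ofReal (le_max_of_le_right ?_)
    have := hA2 x
    rw [neg_sub] at hD1
    linarith

end Drift

/-! ### Transience and recurrence -/

section Conclusion

variable {d : ℕ} {𝕏 : Set (E d)} {P : Kernel 𝕏 𝕏} {x₀ : 𝕏}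
  {Ω : Type*} [MeasurableSpace Ω] {Pr : Measure Ω} {X : ℕ → Ω → 𝕏}

lemma measurable_norm_coe : Measurable fun x : 𝕏 => ‖(x : E d)‖ :=
  measurable_subtype_coe.norm

lemma measurable_logSq_coe : Measurable fun x : 𝕏 => logSq (x : E d) :=
  measurable_logSq.comp measurable_subtype_coe

/-- The walk is almost surely unbounded. -/
lemma IsMarkovProcess.ae_exists_lt_norm [IsMarkovKernel P] [IsProbabilityMeasure Pr]
    (hX : IsMarkovProcess P x₀ Pr X) (hA0 : BoundedMoments P) (hA1 : ZeroDrift P)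
    (hA2 : UniformlyNondegenerate P) (K : ℝ) :
    ∀ᵐ ω ∂Pr, ∃ n, K < ‖(X n ω : E d)‖ := by
  obtain ⟨D, v, hv, hD⟩ := exists_lintegral_max_sub_sq_le hA0 hA1 hA2 K
  have hW : Measurable fun x : 𝕏 => ENNReal.ofReal (max 0 ((2 * D) ^ 2 - ‖(x : E d)‖ ^ 2)) :=
    (measurable_const.max (measurable_const.sub (measurable_norm_coe.pow_const 2))).ennreal_ofReal
  filter_upwards [hX.ae_tsum_ne_top (A := {x : 𝕏 | ‖(x : E d)‖ ≤ K})
    (measurableSet_le measurable_norm_coe measurable_const) hW (fun _ => ENNReal.ofReal_ne_top)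
    (h := fun _ => ENNReal.ofReal v) measurable_const hD 0] with ω hω
  by_contra! hcon
  refine (hω fun k _ => hcon k).1 ?_
  rw [ENNReal.tsum_const_eq_top_of_ne_zero]
  simpa using hv

/-- If `log logSq` decreases in the mean by a radial amount outside a ball, then the walk almost
surely returns to that ball after each time. -/
lemma IsMarkovProcess.ae_exists_norm_lt [IsMarkovKernel P] [IsProbabilityMeasure Pr]
    (hX : IsMarkovProcess P x₀ Pr X) {R U : ℝ} (hU : 0 < U) (hR4 : 4 ≤ R)
    (hR : ∀ x : 𝕏, R ≤ ‖(x : E d)‖ →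
      ∫⁻ y, ENNReal.ofReal (Real.log (logSq (y : E d))) ∂(P x)
        + ENNReal.ofReal (U / (2 * (‖(x : E d)‖ ^ 2 * logSq (x : E d) ^ 2)))
        ≤ ENNReal.ofReal (Real.log (logSq (x : E d)))) (m : ℕ) :
    ∀ᵐ ω ∂Pr, ∃ n, m ≤ n ∧ ‖(X n ω : E d)‖ < R := by
  have hW : Measurable fun x : 𝕏 => ENNReal.ofReal (Real.log (logSq (x : E d))) :=
    (Real.measurable_log.comp measurable_logSq_coe).ennreal_ofReal
  have hh : Measurable fun x : 𝕏 =>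
      ENNReal.ofReal (U / (2 * (‖(x : E d)‖ ^ 2 * logSq (x : E d) ^ 2))) :=
    (measurable_const.div (measurable_const.mul ((measurable_norm_coe.pow_const 2).mul
      (measurable_logSq_coe.pow_const 2)))).ennreal_ofReal
  filter_upwards [hX.ae_tsum_ne_top (A := {x : 𝕏 | R ≤ ‖(x : E d)‖})
    (measurableSet_le measurable_const measurable_norm_coe) hW (fun _ => ENNReal.ofReal_ne_top)
    hh hR m] with ω hω
  by_contra! hcon
  obtain ⟨h1, h2⟩ := hω hcon
  -- finiteness of the sum forces the walk to infinity
  have h3 : Tendsto (fun i => ‖(X (m + i) ω : E d)‖) atTop atTop := by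
    rw [tendsto_atTop]
    intro K'
    set K := max K' 4
    have hK4 : 4 ≤ K := le_max_right _ _
    have hLK : 0 < Real.log (K ^ 2) := Real.log_pos (by nlinarith)
    have hη : 0 < ENNReal.ofReal (U / (2 * (K ^ 2 * Real.log (K ^ 2) ^ 2))) := by
      rw [ENNReal.ofReal_pos]
      positivity
    filter_upwards [(ENNReal.tendsto_atTop_zero_of_tsum_ne_top h1).eventually_lt_const hη]
      with i hi
    by_contra! hlt
    have hle : ‖(X (m + i) ω : E d)‖ ≤ K := hlt.le.trans (le_max_left _ _)
    have hpos : 0 < ‖(X (m + i) ω : E d)‖ := by linarith [hcon (m + i) (Nat.le_add_right _ _)]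
    have hL := logSq_le (by linarith) hle
    have hL0 := logSq_pos (X (m + i) ω : E d)
    refine hi.not_ge (ENNReal.ofReal_le_ofReal ?_)
    gcongr
  -- along such a path the Lyapunov function tends to infinity
  have h4 : Tendsto (fun i => ENNReal.ofReal (Real.log (logSq (X (m + i) ω : E d)))) atTop
      (𝓝 ∞) := by
    refine ENNReal.tendsto_ofReal_nhds_top.2 (Real.tendsto_log_atTop.comp ?_)
    refine tendsto_atTop_mono' _ ?_ (tendsto_log_sq_atTop.comp h3)
    exact Eventually.of_forall fun i => le_max_right _ _
  exact h2 h4.liminf_eq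

/-- If `1 / logSq` does not increase in the mean outside a ball, and the walk is unbounded, then
it almost surely tends to infinity: started from norm at least `K`, it hits a fixed ball with
probability `O(1 / log K)`. -/
lemma IsMarkovProcess.isTransient_of_lintegral_le [IsMarkovKernel P] [IsProbabilityMeasure Pr]
    (hX : IsMarkovProcess P x₀ Pr X) {R : ℝ}
    (hR : ∀ x : 𝕏, R ≤ ‖(x : E d)‖ →
      ∫⁻ y, ENNReal.ofReal (logSq (y : E d))⁻¹ ∂(P x) ≤ ENNReal.ofReal (logSq (x : E d))⁻¹)
    (hunb : ∀ K : ℝ, ∀ᵐ ω ∂Pr, ∃ n, K < ‖(X n ω : E d)‖) :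
    IsTransient Pr X := by
  have hW : Measurable fun x : 𝕏 => ENNReal.ofReal (logSq (x : E d))⁻¹ :=
    measurable_logSq_coe.inv.ennreal_ofReal
  -- `c` is a lower bound of the Lyapunov function on the ball of radius `R'`, which contains the
  -- ball of radius `N` and the region without drift condition
  have main : ∀ N : ℕ, ∀ᵐ ω ∂Pr, ∀ᶠ n in atTop, (N : ℝ) ≤ ‖(X n ω : E d)‖ := by
    intro N
    set R' := max (max R N) 2 with hR'def
    have hR'2 : 2 ≤ R' := le_max_right _ _
    have hNR' : (N : ℝ) ≤ R' := (le_max_right _ _).trans (le_max_left _ _)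
    have hRR' : R ≤ R' := (le_max_left _ _).trans (le_max_left _ _)
    have hLR : 0 < Real.log (R' ^ 2) := Real.log_pos (by nlinarith)
    set c := ENNReal.ofReal (Real.log (R' ^ 2))⁻¹ with hc
    have hc0 : c ≠ 0 := by
      rw [hc, Ne, ENNReal.ofReal_eq_zero, not_le]
      positivity
    have hcW : ∀ x : 𝕏, ‖(x : E d)‖ ≤ R' → c ≤ ENNReal.ofReal (logSq (x : E d))⁻¹ := by
      intro x hx
      refine ENNReal.ofReal_le_ofReal ?_
      have := logSq_pos (x : E d)
      exact inv_anti₀ this (logSq_le hR'2 hx)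
    have hPW : ∀ x : 𝕏, ENNReal.ofReal (logSq (x : E d))⁻¹ < c →
        ∫⁻ y, ENNReal.ofReal (logSq (y : E d))⁻¹ ∂(P x) ≤ ENNReal.ofReal (logSq (x : E d))⁻¹ := by
      intro x hx
      refine hR x (hRR'.trans ?_)
      by_contra! h
      exact hx.not_ge (hcW x h.le)
    set I : Set Ω := {ω | ∃ᶠ n in atTop, ‖(X n ω : E d)‖ < N} with hI
    have hbound : ∀ K : ℝ, 2 ≤ K → c * Pr I ≤ ENNReal.ofReal (Real.log (K ^ 2))⁻¹ := by
      intro K hK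
      -- the event that the level `K` is first reached at time `m`
      set T : ℕ → Set Ω := fun m =>
        {ω | K ≤ ‖(X m ω : E d)‖ ∧ ∀ j < m, ‖(X j ω : E d)‖ < K} with hTdef
      have hTm : ∀ m, MeasurableSet[past X m] (T m) := by
        intro m
        have : T m = X m ⁻¹' {x | K ≤ ‖(x : E d)‖} ∩
            ⋂ j, ⋂ _ : j < m, X j ⁻¹' {x | ‖(x : E d)‖ < K} := by
          ext ω; simp [hTdef]
        rw [this]
        exact (measurable_past le_rfl (measurableSet_le measurable_const measurable_norm_coe)).inter
          (.iInter fun j => .iInter fun hj =>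
            measurable_past hj.le (measurableSet_lt measurable_norm_coe measurable_const))
      have hTdisj : Pairwise (Function.onFun Disjoint T) := by
        intro i j hij
        rw [Function.onFun, Set.disjoint_left]
        rintro ω ⟨h1, h2⟩ ⟨h3, h4⟩
        rcases lt_or_gt_of_ne hij with h | h
        · exact (h4 i h).not_ge h1
        · exact (h2 j h).not_ge h3
      have hhit := fun m => hX.measure_hit_le hW (c := c)
        (b := ENNReal.ofReal (Real.log (K ^ 2))⁻¹) hPW (hTm m) fun ω hω => by
          refine ENNReal.ofReal_le_ofReal ?_
          have : 0 < Real.log (K ^ 2) := Real.log_pos (by nlinarith)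
          exact inv_anti₀ this (le_logSq (by linarith) hω.1)
      have hsub : I ≤ᵐ[Pr] ⋃ m, {ω | ω ∈ T m ∧
          ∃ n, m ≤ n ∧ c ≤ ENNReal.ofReal (logSq (X n ω : E d))⁻¹} := by
        filter_upwards [hunb K] with ω hω hωI
        classical
        have hω' : ∃ n, K ≤ ‖(X n ω : E d)‖ := hω.imp fun _ h => h.le
        obtain ⟨n, hn, hnN⟩ := (frequently_atTop.1 hωI) (Nat.find hω')
        refine Set.mem_iUnion.2 ⟨Nat.find hω',
          ⟨Nat.find_spec hω', fun j hj => not_le.1 (Nat.find_min hω' hj)⟩, n, hn, ?_⟩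
        exact hcW _ (hnN.le.trans hNR')
      calc c * Pr I ≤ c * ∑' m, Pr {ω | ω ∈ T m ∧
            ∃ n, m ≤ n ∧ c ≤ ENNReal.ofReal (logSq (X n ω : E d))⁻¹} := by
            gcongr
            exact (measure_mono_ae hsub).trans (measure_iUnion_le _)
        _ ≤ ∑' m, ENNReal.ofReal (Real.log (K ^ 2))⁻¹ * Pr (T m) := by
            rw [← ENNReal.tsum_mul_left]
            exact ENNReal.tsum_le_tsum hhit
        _ = ENNReal.ofReal (Real.log (K ^ 2))⁻¹ * Pr (⋃ m, T m) := by
            rw [ENNReal.tsum_mul_left,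
              measure_iUnion hTdisj fun m => past_le hX.measurable m _ (hTm m)]
        _ ≤ _ := mul_le_of_le_one_right' prob_le_one
    have hlim : Tendsto (fun K : ℝ => ENNReal.ofReal (Real.log (K ^ 2))⁻¹) atTop (𝓝 0) := by
      have := ENNReal.tendsto_ofReal tendsto_log_sq_atTop.inv_tendsto_atTop
      simpa using this
    have h0 : c * Pr I ≤ 0 := ge_of_tendsto hlim ((eventually_ge_atTop 2).mono hbound)
    have hI0 : Pr I = 0 := (mul_eq_zero.1 (le_antisymm h0 bot_le)).resolve_left hc0
    filter_upwards [measure_eq_zero_iff_ae_notMem.1 hI0] with ω hω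
    simpa [hI] using hω
  filter_upwards [ae_all_iff.2 main] with ω hω
  rw [tendsto_atTop]
  intro b
  obtain ⟨N, hN⟩ := exists_nat_ge b
  exact (hω N).mono fun n hn => hN.trans hn

/-- Recurrence, from the smallness of the covariance error compared with the distance of `2U`
from `V`, or compared with `1 / log r`. -/
lemma IsMarkovProcess.isRecurrent_of_eventually [NeZero d] [IsMarkovKernel P]
    [IsProbabilityMeasure Pr] (hX : IsMarkovProcess P x₀ Pr X) (hA0 : BoundedMoments P)
    (hA1 : ZeroDrift P) {σsq : S d → Matrix (Fin d) (Fin d) ℝ}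
    {U V : ℝ} (hA4 : CovForm σsq U V)
    (hε : ∀ᶠ r in atTop, ∃ e : ℝ, 0 ≤ e ∧ e ≤ U / 4 ∧ covError P σsq r ≤ ENNReal.ofReal e ∧
      (V - 2 * U + (d + 2) * e) * Real.log (r ^ 2) ≤ U / 2) :
    IsRecurrent Pr X := by
  obtain ⟨R, hR4, hR⟩ := exists_lintegral_log_logSq_le hA0 hA1 hA4 hε
  refine ⟨R.toNNReal, ?_⟩
  filter_upwards [ae_all_iff.2 (hX.ae_exists_norm_lt hA4.1 hR4 hR)] with ω hω
  refine liminf_le_of_frequently_le' (frequently_atTop.2 fun m => ?_)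
  obtain ⟨n, hn, hlt⟩ := hω m
  refine ⟨n, hn, ?_⟩
  rw [← ofReal_norm]
  exact ENNReal.ofReal_le_ofReal hlt.le

end Conclusion

end ZeroDriftWalk

theorem mainTheorem1 {d : ℕ} [NeZero d]
    {𝕏 : Set (ZeroDriftWalk.E d)} (h𝕏 : MeasurableSet 𝕏) (h𝕏unb : ¬ Bornology.IsBounded 𝕏)
    (P : Kernel 𝕏 𝕏) [IsMarkovKernel P] (x₀ : 𝕏)
    {Ω : Type*} [MeasurableSpace Ω] (Pr : Measure Ω) [IsProbabilityMeasure Pr]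
    (X : ℕ → Ω → 𝕏) (hX : ZeroDriftWalk.IsMarkovProcess P x₀ Pr X)
    (hA0 : ZeroDriftWalk.BoundedMoments P)
    (hA1 : ZeroDriftWalk.ZeroDrift P)
    (hA2 : ZeroDriftWalk.UniformlyNondegenerate P)
    (σsq : ZeroDriftWalk.S d → Matrix (Fin d) (Fin d) ℝ)
    (hA3 : ZeroDriftWalk.CovLimit P σsq)
    (U V : ℝ) (hA4 : ZeroDriftWalk.CovForm σsq U V) :
    (2 * U < V → ZeroDriftWalk.IsTransient Pr X) ∧
    (V < 2 * U → ZeroDriftWalk.IsRecurrent Pr X) ∧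
    (2 * U = V → ZeroDriftWalk.PolynomialRate (ZeroDriftWalk.covError P σsq) →
      ZeroDriftWalk.IsRecurrent Pr X) := by
  have hU := hA4.1
  refine ⟨fun hUV => ?_, fun hUV => ?_, fun hUV hrate => ?_⟩
  · obtain ⟨R, hR⟩ := ZeroDriftWalk.exists_lintegral_inv_logSq_le hA0 hA1 hA3 hA4 hUV
    exact hX.isTransient_of_lintegral_le hR (hX.ae_exists_lt_norm hA0 hA1 hA2)
  · refine hX.isRecurrent_of_eventually hA0 hA1 hA4 ?_
    -- a constant bound on the error makes the bracket nonpositive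
    set e := min (U / 4) ((2 * U - V) / (d + 2)) with he
    have he0 : 0 < e := lt_min (by positivity) (div_pos (by linarith) (by positivity))
    filter_upwards [hA3.2.eventually_le_const
      (by simpa using he0 : (0 : ℝ≥0∞) < ENNReal.ofReal e), eventually_ge_atTop 1] with r hr hr1
    refine ⟨e, he0.le, min_le_left _ _, hr, ?_⟩
    have h1 : e ≤ (2 * U - V) / (d + 2) := min_le_right _ _
    rw [le_div_iff₀ (by positivity)] at h1
    have h2 : 0 ≤ Real.log (r ^ 2) := Real.log_nonneg (by nlinarith)
    have h3 : (V - 2 * U + (d + 2) * e) * Real.log (r ^ 2) ≤ 0 :=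
      mul_nonpos_of_nonpos_of_nonneg (by linarith) h2
    linarith
  · refine hX.isRecurrent_of_eventually hA0 hA1 hA4 ?_
    obtain ⟨δ, hδ, C, hC⟩ := hrate
    have t0 := (ZeroDriftWalk.tendsto_log_sq_pow_mul_rpow hδ 0).const_mul (max C 0)
    have t1 := (ZeroDriftWalk.tendsto_log_sq_pow_mul_rpow hδ 1).const_mul ((d + 2) * max C 0)
    filter_upwards [hC, eventually_gt_atTop 0,
      t0.eventually_le_const (by rw [mul_zero]; positivity : _ < U / 4),
      t1.eventually_le_const (by rw [mul_zero]; positivity : _ < U / 2)] with r h1 h2 h3 h4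
    have hr : 0 ≤ r ^ (-δ) := by positivity
    refine ⟨max C 0 * r ^ (-δ), by positivity, ?_, h1.trans ?_, ?_⟩
    · simpa using h3
    · refine ENNReal.ofReal_le_ofReal ?_
      gcongr
      exact le_max_left _ _
    · rw [pow_one] at h4
      have : (V - 2 * U + (d + 2) * (max C 0 * r ^ (-δ))) * Real.log (r ^ 2)
          = (d + 2) * max C 0 * (Real.log (r ^ 2) * r ^ (-δ)) := by
        rw [← hUV]
        ring
      rw [this]
      exact h4
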